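/- For all constants $a,c,k\in\mathbb{N}$ there are constants $K$ and $B$ such that the following holds for all $n,\Delta\in\mathbb{N}$ and every nonempty finite color space $\mathcal{C}$ of size $|\mathcal{C}|\le 2^{a(\Delta^c+1)}$ (that is, $|\mathcal{C}|=2^{\mathrm{poly}(\Delta)}$), where $n$, $\Delta$ and $\mathcal{C}$ are known to all nodes. There is a deterministic algorithm in the LOCAL model that solves $(deg+1)$-list coloring on all $n$-node graphs $G=(V,E)$ of maximum degree at most $\Delta$ whose nodes have distinct identifiers from $\{0,\dots,n^k-1\}$: whenever every node $v$ is given a list $L_v\subseteq\mathcal{C}$ with $|L_v|\ge \deg(v)+1$, every node $v$ outputs a color from $L_v$ such that adjacent nodes output different colors. The algorithm takes at most $$K\cdot\big(\sqrt{\Delta\log_2\Delta}+1\big)+\tfrac12\log^* n$$ rounds, i.e. $O(\sqrt{\Delta\log\Delta})+\frac12\log^* n$ rounds for $\Delta\ge 2$ (with $\Delta\log_2\Delta:=0$ for $\Delta=0$). Furthermore, every node sends only CONGEST messages, i.e. messages of at most $B\lfloor\log_2 n\rfloor$ bits, with the exception of at most one round, in which it broadcasts a single message to all its neighbors; this message consists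 of a subset of its list $L_v$. (LOCAL model: the nodes of $G$ communicate in synchronous rounds; at the beginning a node knows its identifier, its degree, its list and the global parameters, and can tell its incident edges apart only by an arbitrary local numbering; in each round it sends one message of arbitrary size to each neighbor; local computation is unrestricted. $\log^* n$ is the least $i\ge 0$ such that the $i$-fold iterated binary logarithm of $n$ is at most $1$.) -/

import Mathlib

/-- Iterating the binary logarithm eventually brings every real number to a value at most `1`. -/
theorem exists_iterate_logb_le_one (x : ℝ) : ∃ i : ℕ, (Real.logb 2)^[i] x ≤ 1 := by
  have key : ∀ (N : ℕ) (y : ℝ), y ≤ (N : ℝ) + 1 → ∃ i : ℕ, (Real.logb 2)^[i] y ≤ 1 := by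
    intro N
    induction N with
    | zero => intro y hy; exact ⟨0, by simpa using hy⟩
    | succ N ih =>
      intro y hy
      push_cast at hy
      by_cases h2 : y ≤ 2
      · by_cases h1 : y ≤ 1
        · exact ⟨0, by simpa using h1⟩
        · refine ⟨1, ?_⟩
          have hy0 : (0 : ℝ) < y := by linarith
          have := Real.logb_le_logb_of_le (b := 2) (by norm_num) hy0 h2
          rw [Real.logb_self_eq_one (by norm_num)] at this
          simpa using this
      · have hy2 : (2 : ℝ) < y := by linarith
        have hB : y ≤ (2 : ℝ) ^ (y - 1) := by
          have := one_add_mul_self_le_rpow_one_add (s := 1) (by norm_num) (p := y - 1) (by linarith)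
          norm_num at this
          linarith
        have hl : Real.logb 2 y ≤ y - 1 :=
          (Real.logb_le_iff_le_rpow (by norm_num) (by linarith)).2 hB
        obtain ⟨i, hi⟩ := ih (Real.logb 2 y) (by linarith)
        exact ⟨i + 1, by simpa [Function.iterate_succ_apply] using hi⟩
  obtain ⟨N, hN⟩ := exists_nat_ge x
  exact key N x (by linarith)

open Classical in
/-- The iterated logarithm `log* n`: the least number of times the binary logarithm has to be
applied to `n` to reach a value at most `1`. -/
noncomputable def logStar (n : ℕ) : ℕ := Nat.find (exists_iterate_logb_le_one n)

/-- A message: a bit string of any length, or a set of colors from the color space `C`.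
Silence is the empty bit string. -/
inductive Message (C : Type) : Type where
  | bits (b : List Bool) : Message C
  | colors (S : Finset C) : Message C

/-- A deterministic synchronous message-passing algorithm (LOCAL model) for list coloring problems
with color space `C`. Every node runs the same code, local computation is unrestricted, and
a node refers to its neighbors only through its ports `0, 1, ..., deg - 1`. -/
structure LocalAlgorithm (C : Type) where
  /-- local states of a node -/
  State : Type
  /-- initial state, computed from the node's identifier, its degree and its list -/
  init : (ident : ℕ) → (deg : ℕ) → (list : Finset C) → State
  /-- message sent through the given port, in a round begun in the given state -/
  send : State → (port : ℕ) → Message C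
  /-- state at the end of a round, given the received messages in the order of the ports -/
  receive : State → (inbox : List (Message C)) → State
  /-- color chosen by a node that stops in the given state -/
  output : State → C

/-- A port numbering of a graph: every node numbers its neighbors by `0, 1, ..., deg - 1`. -/
def PortNumbering {V : Type} [Fintype V] (G : SimpleGraph V) [DecidableRel G.Adj] : Type :=
  (v : V) → Fin (G.degree v) ≃ G.neighborSet v

namespace LocalAlgorithm

variable {C V : Type} [Fintype V]

/-- The state of every node after `t` rounds. In each round a node sends one message through each
of its ports and receives the messages that its neighbors send through their ports towards it. -/
def state (A : LocalAlgorithm C) (G : SimpleGraph V) [DecidableRel G.Adj] (p : PortNumbering G)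
    (ident : V → ℕ) (L : V → Finset C) : ℕ → V → A.State
  | 0, v => A.init (ident v) (G.degree v) (L v)
  | t + 1, v => A.receive (state A G p ident L t v)
      (List.ofFn fun i : Fin (G.degree v) =>
        A.send (state A G p ident L t (p v i))
          ((p (p v i)).symm ⟨v, G.adj_symm (p v i).2⟩ : Fin (G.degree (p v i))))

/-- The message that node `v` sends through its port `i` in round `t` (rounds are `0, 1, ...`). -/
def sent (A : LocalAlgorithm C) (G : SimpleGraph V) [DecidableRel G.Adj] (p : PortNumbering G)
    (ident : V → ℕ) (L : V → Finset C) (t : ℕ) (v : V) (i : Fin (G.degree v)) : Message C :=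
  A.send (A.state G p ident L t v) i

/-- The color that node `v` outputs if all nodes stop after `T` rounds. -/
def color (A : LocalAlgorithm C) (G : SimpleGraph V) [DecidableRel G.Adj] (p : PortNumbering G)
    (ident : V → ℕ) (L : V → Finset C) (T : ℕ) (v : V) : C :=
  A.output (A.state G p ident L T v)

end LocalAlgorithm

/-- `c` is a proper coloring of `G` that takes the color of each node from its list. -/
def IsListColoring {C V : Type} (G : SimpleGraph V) (L : V → Finset C) (c : V → C) : Prop :=
  (∀ v, c v ∈ L v) ∧ ∀ u v, G.Adj u v → c u ≠ c v

/-- During the first `T` rounds, every node sends only bit strings of length at most `b`, with the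
exception of at most one round, in which it broadcasts one subset of its list to all neighbors. -/
def OneListMessage {C V : Type} [Fintype V] (A : LocalAlgorithm C) (G : SimpleGraph V)
    [DecidableRel G.Adj] (p : PortNumbering G) (ident : V → ℕ) (L : V → Finset C)
    (T b : ℕ) : Prop :=
  ∀ v : V, ∃ t₀ : ℕ, ∃ S : Finset C, S ⊆ L v ∧ ∀ t < T,
    (∀ i, ∃ w : List Bool, A.sent G p ident L t v i = Message.bits w ∧ w.length ≤ b) ∨
    (t = t₀ ∧ ∀ i, A.sent G p ident L t v i = Message.colors S)

/-! A node's public state consists of five bounded numbers and a set of colors. A rule updates it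
from the states of the neighbors. A legal update rewrites the numbers or publishes one palette,
never both, so one message announces it, and a program of `T` rules costs `T` rounds
(`simulation_spec`). A palette is nonempty and can only replace the empty set, so it is broadcast at
most once.

First phase: reduce the identifiers to polynomially many colors in the degree. For fixed degree, one
round based on bit tests turns `2 ^ 2 ^ l` colors into polynomially many in `l`. It thus removes two
logarithms, which is where the factor `1/2` before `log*` comes from (`reducesWithin_logStar`). What
remains is a tower of bounded height in the degree, and four rounds of Linial's reduction flatten it
(`exists_reducesWithin_pow`).

Second phase: stages that each at least halve the number `δ` of uncolored neighbors of an uncolored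
node. In `q` rounds the nodes join classes given by values of polynomials over a field of size `q`.
Every node ends up with at most `β` neighbors in its own class that joined no later than it did;
this works once `q * (β + 1)` exceeds a constant times `δ`. The classes are then processed one by
one. A node with at least `l` available colors publishes `l` of them, picks a candidate subset, and
takes a color of it outside the picks of those at most `β` neighbors. Of two adjacent nodes of a
class, the one that joined later avoids the whole pick of the other, so their colors differ. A node
with fewer than `l` available colors has few uncolored neighbors, because its list exceeds its
degree, and it waits for the next stage (`run_stageRules`).

The candidate subsets come from a counting argument (`exists_isListFamily`): random transversals of
a list meet those of another list in few colors, and a union bound over all pairs of color and list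
applies since the color space has size `2 ^ poly`. The cost is `l ≈ β² log N`, so `β ≈ √(δ / log N)`
and a stage takes about `√(δ log N)` rounds. These lengths form a geometric sum. Once `δ` is a small
power of `N`, a stage with `β = 0` colors everything (`exists_colorsWithin`). -/

/-! ### Programs of rules on public node states. -/

/-- The numerical part of the publicly known state of a node. -/
structure NodeVars where
  color : ℕ
  status : ℕ
  cls : ℕ
  time : ℕ
  index : ℕ

/-- All entries are smaller than `M`. -/
def NodeVars.Bounded (x : NodeVars) (M : ℕ) : Prop :=
  x.color < M ∧ x.status < M ∧ x.cls < M ∧ x.time < M ∧ x.index < M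

/-- The publicly known state of a node: some numbers, and the set of colors it has broadcast. -/
structure NodeState (C : Type) where
  vars : NodeVars
  palette : Finset C

/-- A rule that proposes the next state of a node from its list, its state and the states of its
neighbors. -/
abbrev RoundRule (C : Type) := Finset C → NodeState C → Multiset (NodeState C) → NodeState C

/-- A change of state that a node can announce by one message: either small numbers, or a nonempty
subset of its list, provided that it has not announced such a set before. -/
def IsLegal {C : Type} (M : ℕ) (L : Finset C) (s s' : NodeState C) : Prop :=
  (s'.palette = s.palette ∧ s'.vars.Bounded M) ∨
    (s'.vars = s.vars ∧ s.palette = ∅ ∧ s'.palette.Nonempty ∧ s'.palette ⊆ L)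

open Classical in
/-- Apply a rule if the change of state that it proposes is legal. -/
noncomputable def advance {C : Type} (M : ℕ) (r : RoundRule C) (L : Finset C) (s : NodeState C)
    (nbrs : Multiset (NodeState C)) : NodeState C :=
  if IsLegal M L s (r L s nbrs) then r L s nbrs else s

section Run

variable {C V : Type} [Fintype V]

/-- All nodes apply a rule. -/
noncomputable def runRound (M : ℕ) (G : SimpleGraph V) [DecidableRel G.Adj] (L : V → Finset C)
    (s : V → NodeState C) (r : RoundRule C) : V → NodeState C :=
  fun v => advance M r (L v) (s v) ((G.neighborFinset v).val.map s)

/-- All nodes apply a list of rules one after another. -/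
noncomputable def run (M : ℕ) (G : SimpleGraph V) [DecidableRel G.Adj] (L : V → Finset C)
    (prog : List (RoundRule C)) (s : V → NodeState C) : V → NodeState C :=
  prog.foldl (runRound M G L) s

/-- The initial state of a node with the given identifier. -/
def startState (C : Type) (ident : ℕ) : NodeState C := ⟨⟨ident, 0, 0, 0, 0⟩, ∅⟩

theorem run_append (M : ℕ) (G : SimpleGraph V) [DecidableRel G.Adj] (L : V → Finset C)
    (p₁ p₂ : List (RoundRule C)) (s : V → NodeState C) :
    run M G L (p₁ ++ p₂) s = run M G L p₂ (run M G L p₁ s) := by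
  simp [run]

theorem run_take_succ (M : ℕ) (G : SimpleGraph V) [DecidableRel G.Adj] (L : V → Finset C)
    (prog : List (RoundRule C)) (s : V → NodeState C) (t : ℕ) (ht : t < prog.length) :
    run M G L (prog.take (t + 1)) s = runRound M G L (run M G L (prog.take t) s) prog[t] := by
  rw [List.take_succ_eq_append_getElem ht, run_append]
  simp [run]

end Run

theorem advance_cases {C : Type} (M : ℕ) (r : RoundRule C) (L : Finset C) (s : NodeState C)
    (nbrs : Multiset (NodeState C)) :
    advance M r L s nbrs = s ∨ IsLegal M L s (advance M r L s nbrs) := by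
  unfold advance
  split_ifs with h
  · exact Or.inr h
  · exact Or.inl rfl

/-! ### Executing a program in the LOCAL model. -/

/-- There are `M ^ 5` bounded records, and they inject into the bit strings of length `b`. Unbounded
records may be encoded arbitrarily, as they never occur in a run. -/
theorem exists_encoding (M b : ℕ) (h : M ^ 5 ≤ 2 ^ b) :
    ∃ (enc : NodeVars → List Bool) (dec : List Bool → NodeVars),
      (∀ x, (enc x).length ≤ b) ∧ ∀ x, x.Bounded M → dec (enc x) = x := by
  classical
  have hc : Fintype.card (Fin 5 → Fin M) ≤ Fintype.card (Fin b → Bool) := by simpa using h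
  obtain ⟨φ⟩ := Function.Embedding.nonempty_of_card_le hc
  let tup : (x : NodeVars) → x.Bounded M → Fin 5 → Fin M := fun x hx =>
    ![⟨x.color, hx.1⟩, ⟨x.status, hx.2.1⟩, ⟨x.cls, hx.2.2.1⟩, ⟨x.time, hx.2.2.2.1⟩,
      ⟨x.index, hx.2.2.2.2⟩]
  let enc : NodeVars → List Bool := fun x =>
    if hx : x.Bounded M then List.ofFn (φ (tup x hx)) else []
  have hinj : Set.InjOn enc {x | x.Bounded M} := by
    intro x hx y hy hxy
    have hx' : x.Bounded M := hx
    have hy' : y.Bounded M := hy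
    simp only [enc, hx', hy', dif_pos] at hxy
    have h1 := φ.injective (List.ofFn_injective hxy)
    have e0 := congrArg Fin.val (congrFun h1 0)
    have e1 := congrArg Fin.val (congrFun h1 1)
    have e2 := congrArg Fin.val (congrFun h1 2)
    have e3 := congrArg Fin.val (congrFun h1 3)
    have e4 := congrArg Fin.val (congrFun h1 4)
    cases x; cases y
    simp_all [tup]
  have : Nonempty NodeVars := ⟨⟨0, 0, 0, 0, 0⟩⟩
  refine ⟨enc, Function.invFunOn enc {x | x.Bounded M}, fun x => ?_, fun x hx => ?_⟩
  · by_cases hx : x.Bounded M <;> simp [enc, hx]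
  · exact hinj.leftInvOn_invFunOn hx

/-- Local state of a node that executes a list of rules. -/
structure SimState (C : Type) where
  rest : List (RoundRule C)
  list : Finset C
  own : NodeState C
  fresh : Prop
  known : List (NodeState C)

/-- Update the recorded state of a neighbor by its message. -/
def recordMessage {C : Type} (dec : List Bool → NodeVars) (k : NodeState C) :
    Message C → NodeState C
  | Message.bits w => ⟨dec w, k.palette⟩
  | Message.colors S => ⟨k.vars, S⟩

open Classical in
/-- The algorithm in which all nodes execute a list of rules. -/
noncomputable def simulation {C : Type} (M : ℕ) (enc : NodeVars → List Bool)
    (dec : List Bool → NodeVars) (prog : List (RoundRule C)) (out : NodeState C → C) :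
    LocalAlgorithm C where
  State := SimState C
  init ident deg L := ⟨prog, L, startState C ident, False, List.replicate deg (startState C 0)⟩
  send σ _ := if σ.fresh then Message.colors σ.own.palette else Message.bits (enc σ.own.vars)
  receive σ inbox :=
    let known := List.zipWith (recordMessage dec) σ.known inbox
    match σ.rest with
    | [] => { σ with known := known }
    | r :: rest =>
      let own := advance M r σ.list σ.own known
      ⟨rest, σ.list, own, own.palette ≠ σ.own.palette, known⟩
  output σ := out σ.own

theorem coe_ofFn_ports {V α : Type} [Fintype V] (G : SimpleGraph V) [DecidableRel G.Adj]
    (p : PortNumbering G) (v : V) (s : V → α) :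
    ((List.ofFn fun i : Fin (G.degree v) => s (p v i) : List α) : Multiset α) =
      (G.neighborFinset v).val.map s := by
  classical
  rw [← Fin.univ_val_map]
  have h : G.neighborFinset v = (Finset.univ : Finset (Fin (G.degree v))).map
      ((p v).toEmbedding.trans (Function.Embedding.subtype _)) := by
    ext u
    simp only [SimpleGraph.mem_neighborFinset, Finset.mem_map, Finset.mem_univ, true_and]
    constructor
    · intro hu
      exact ⟨(p v).symm ⟨u, hu⟩, by simp⟩
    · rintro ⟨i, rfl⟩
      exact (p v i).2
  rw [h, Finset.map_val, Multiset.map_map]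
  rfl

section Simulation

variable {C V : Type} [Fintype V]

theorem zipWith_ofFn_self {α β γ : Type} {n : ℕ} (f : α → β → γ) (a : Fin n → α) (b : Fin n → β) :
    List.zipWith f (List.ofFn a) (List.ofFn b) = List.ofFn fun i => f (a i) (b i) := by
  apply List.ext_getElem <;> simp

theorem run_take_bounded (M : ℕ) (G : SimpleGraph V) [DecidableRel G.Adj] (L : V → Finset C)
    (prog : List (RoundRule C)) (ident : V → ℕ) (hid : ∀ v, ident v < M) (t : ℕ)
    (ht : t ≤ prog.length) (v : V) :
    (run M G L (prog.take t) (fun v => startState C (ident v)) v).vars.Bounded M := by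
  induction t with
  | zero =>
    have := hid v
    have h0 : 0 < M := by omega
    simp [run, startState, NodeVars.Bounded, this, h0]
  | succ t ih =>
    rw [run_take_succ _ _ _ _ _ _ (by omega)]
    have ih := ih (by omega)
    unfold runRound
    rcases advance_cases M prog[t] (L v) (run M G L (prog.take t) (fun v => startState C (ident v)) v)
      ((G.neighborFinset v).val.map (run M G L (prog.take t) fun v => startState C (ident v))) with h | h
    · rw [h]; exact ih
    · rcases h with ⟨_, h⟩ | ⟨h, _⟩
      · exact h
      · rw [h]; exact ih

theorem run_take_step (M : ℕ) (G : SimpleGraph V) [DecidableRel G.Adj] (L : V → Finset C)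
    (prog : List (RoundRule C)) (s : V → NodeState C) (t : ℕ)
    (ht : t < prog.length) (v : V) :
    (run M G L (prog.take (t + 1)) s v).palette = (run M G L (prog.take t) s v).palette ∨
    ((run M G L (prog.take (t + 1)) s v).vars = (run M G L (prog.take t) s v).vars ∧
      (run M G L (prog.take t) s v).palette = ∅ ∧
      (run M G L (prog.take (t + 1)) s v).palette.Nonempty ∧
      (run M G L (prog.take (t + 1)) s v).palette ⊆ L v) := by
  rw [run_take_succ _ _ _ _ _ _ ht]
  unfold runRound
  rcases advance_cases M prog[t] (L v) (run M G L (prog.take t) s v)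
    ((G.neighborFinset v).val.map (run M G L (prog.take t) s)) with h | h
  · exact Or.inl (by rw [h])
  · rcases h with ⟨h, _⟩ | h
    · exact Or.inl h
    · exact Or.inr h

/-- The record `K` of a neighbor lags behind by one rule, but at least one half of it, numbers or
palette, is up to date. The other half is exactly what the neighbor's next message carries, so no
extra round per rule is needed. -/
theorem simulation_state (M : ℕ) (enc : NodeVars → List Bool) (dec : List Bool → NodeVars)
    (hdec : ∀ x, x.Bounded M → dec (enc x) = x) (prog : List (RoundRule C)) (out : NodeState C → C)
    (G : SimpleGraph V) [DecidableRel G.Adj] (p : PortNumbering G) (ident : V → ℕ)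
    (L : V → Finset C) (hid : ∀ v, ident v < M) (t : ℕ) (ht : t ≤ prog.length) :
    ∃ K : V → NodeState C, ∀ v,
      (((run M G L (prog.take t) (fun v => startState C (ident v)) v).palette ≠
          (run M G L (prog.take (t - 1)) (fun v => startState C (ident v)) v).palette ∧
        (K v).vars = (run M G L (prog.take t) (fun v => startState C (ident v)) v).vars) ∨
      ((run M G L (prog.take t) (fun v => startState C (ident v)) v).palette =
          (run M G L (prog.take (t - 1)) (fun v => startState C (ident v)) v).palette ∧
        (K v).palette = (run M G L (prog.take t) (fun v => startState C (ident v)) v).palette)) ∧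
      (simulation M enc dec prog out).state G p ident L t v =
        (⟨prog.drop t, L v, run M G L (prog.take t) (fun v => startState C (ident v)) v,
          (run M G L (prog.take t) (fun v => startState C (ident v)) v).palette ≠
          (run M G L (prog.take (t - 1)) (fun v => startState C (ident v)) v).palette,
          List.ofFn fun i => K (p v i)⟩ : SimState C) := by
  induction t with
  | zero =>
    -- Identifiers of neighbors are still unknown, but the empty palette is right; the first message
    -- supplies the numbers.
    refine ⟨fun _ => startState C 0, fun v => ⟨Or.inr ⟨rfl, rfl⟩, ?_⟩⟩
    simp [LocalAlgorithm.state, simulation, run]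
  | succ t ih =>
    obtain ⟨K, hK⟩ := ih (by omega)
    refine ⟨run M G L (prog.take t) (fun v => startState C (ident v)), fun v => ⟨?_, ?_⟩⟩
    · rcases run_take_step M G L prog (fun v => startState C (ident v)) t (by omega) v with h | h
      · exact Or.inr ⟨by simpa using h, h.symm⟩
      · refine Or.inl ⟨?_, h.1.symm⟩
        rw [Nat.add_sub_cancel, h.2.1]
        exact h.2.2.1.ne_empty
    · have hmsg : ∀ u (q : ℕ), recordMessage dec (K u) ((simulation M enc dec prog out).send
          ((simulation M enc dec prog out).state G p ident L t u) q) =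
          run M G L (prog.take t) (fun v => startState C (ident v)) u := by
        intro u q
        rw [(hK u).2]
        rcases (hK u).1 with h | h
        · simp only [simulation, ne_eq, h.1, not_false_eq_true, if_true, recordMessage]
          rw [h.2]
        · simp only [simulation, ne_eq, h.1, not_true_eq_false, if_false, recordMessage]
          rw [hdec _ (run_take_bounded M G L prog ident hid t (by omega) u), h.2]
      have hin : List.zipWith (recordMessage dec) (List.ofFn fun i => K (p v i))
          (List.ofFn fun i : Fin (G.degree v) => (simulation M enc dec prog out).send
            ((simulation M enc dec prog out).state G p ident L t (p v i))
            ((p (p v i)).symm ⟨v, G.adj_symm (p v i).2⟩ : Fin (G.degree (p v i)))) =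
          List.ofFn fun i => run M G L (prog.take t) (fun v => startState C (ident v)) (p v i) := by
        rw [zipWith_ofFn_self]
        congr 1
        funext i
        exact hmsg _ _
      rw [LocalAlgorithm.state, (hK v).2]
      have hd : prog.drop t = prog[t] :: prog.drop (t + 1) := List.drop_eq_getElem_cons (by omega)
      rw [run_take_succ _ _ _ _ _ _ (by omega : t < prog.length)]
      rw [hd]
      conv_lhs => simp only [simulation]
      simp only [simulation] at hin
      simp only [hin, coe_ofFn_ports, Nat.add_sub_cancel]
      rfl

/-- Executing a list of rules is an algorithm of the LOCAL model in which every node broadcasts at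
most one set of colors, a subset of its list. -/
theorem simulation_spec (M b : ℕ) (enc : NodeVars → List Bool) (dec : List Bool → NodeVars)
    (hlen : ∀ x, (enc x).length ≤ b)
    (hdec : ∀ x, x.Bounded M → dec (enc x) = x) (prog : List (RoundRule C)) (out : NodeState C → C)
    (G : SimpleGraph V) [DecidableRel G.Adj] (p : PortNumbering G) (ident : V → ℕ)
    (L : V → Finset C) (hid : ∀ v, ident v < M) :
    (∀ v, (simulation M enc dec prog out).color G p ident L prog.length v =
      out (run M G L prog (fun v => startState C (ident v)) v)) ∧
    OneListMessage (simulation M enc dec prog out) G p ident L prog.length b := by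
  constructor
  · intro v
    obtain ⟨K, hK⟩ := simulation_state M enc dec hdec prog out G p ident L hid prog.length le_rfl
    unfold LocalAlgorithm.color
    rw [(hK v).2]
    simp [simulation]
  · intro v
    set s : ℕ → NodeState C := fun t => run M G L (prog.take t) (fun v => startState C (ident v)) v
      with hs
    have hsent : ∀ t < prog.length, ∀ i,
        ((s t).palette ≠ (s (t - 1)).palette →
          (simulation M enc dec prog out).sent G p ident L t v i = Message.colors (s t).palette) ∧
        ((s t).palette = (s (t - 1)).palette →
          (simulation M enc dec prog out).sent G p ident L t v i =
            Message.bits (enc (s t).vars)) := by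
      intro t ht i
      obtain ⟨K, hK⟩ := simulation_state M enc dec hdec prog out G p ident L hid t ht.le
      unfold LocalAlgorithm.sent
      rw [(hK v).2]
      constructor <;> intro h
      · simp only [simulation]
        rw [if_pos h]
      · simp only [simulation]
        rw [if_neg (not_not.2 h)]
    by_cases hex : ∃ t₀ < prog.length, (s t₀).palette ≠ (s (t₀ - 1)).palette
    · obtain ⟨t₀, ht₀, hne⟩ := hex
      have hstep := fun t ht => run_take_step M G L prog (fun v => startState C (ident v)) t ht v
      -- A nonempty palette is final, since a legal change of palette starts from the empty set.
      have hkeep : ∀ t ≤ prog.length, ∀ t' ≤ t, (s t').palette.Nonempty →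
          (s t).palette = (s t').palette := by
        intro t
        induction t with
        | zero =>
          intro _ t' ht' _
          obtain rfl : t' = 0 := by omega
          rfl
        | succ t ih =>
          intro h1 t' ht' hn
          rcases Nat.lt_or_ge t t' with h | h
          · obtain rfl : t' = t + 1 := by omega
            rfl
          · have := ih (by omega) t' h hn
            rcases hstep t (by omega) with h2 | h2
            · exact h2.trans this
            · exact absurd h2.2.1 (by rw [show (run M G L (prog.take t) (fun v => startState C (ident v)) v).palette = _ from this]; exact hn.ne_empty)
      obtain ⟨t₁, rfl⟩ : ∃ t₁, t₀ = t₁ + 1 := by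
        cases t₀ with
        | zero => exact absurd rfl hne
        | succ t => exact ⟨t, rfl⟩
      rw [Nat.add_sub_cancel] at hne
      rcases hstep t₁ (by omega) with h2 | ⟨-, hemp, hnon, hsub⟩
      · exact absurd h2 hne
      -- A palette set by rule `t₁` is announced one round later.
      refine ⟨t₁ + 1, (s (t₁ + 1)).palette, hsub, fun t ht => ?_⟩
      by_cases htt : t = t₁ + 1
      · subst htt
        exact Or.inr ⟨rfl, fun i => (hsent _ ht i).1 (by simpa using hne)⟩
      · left
        have heq : (s t).palette = (s (t - 1)).palette := by
          rcases Nat.lt_or_ge t (t₁ + 1) with h | h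
          · have hz : ∀ t' ≤ t₁, (s t').palette = ∅ := by
              intro t' ht'
              by_contra hc
              have := hkeep t₁ (by omega) t' ht' (Finset.nonempty_iff_ne_empty.2 hc)
              exact hc (this.symm.trans hemp)
            rw [hz t (by omega), hz (t - 1) (by omega)]
          · rw [hkeep t ht.le (t₁ + 1) h hnon, hkeep (t - 1) (by omega) (t₁ + 1) (by omega) hnon]
        exact fun i => ⟨_, (hsent t ht i).2 heq, hlen _⟩
    · push Not at hex
      exact ⟨0, ∅, by simp, fun t ht => Or.inl fun i => ⟨_, (hsent t ht i).2 (hex t ht), hlen _⟩⟩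

end Simulation

/-! ### Code families from polynomials over prime fields. -/

/-- A family of functions on `{0, ..., q - 1}`, indexed by `{0, ..., m - 1}`, such that two of them
agree in at most `D` points and none of them takes a value more than `D` times. -/
structure IsCodeFamily (m q D : ℕ) (f : ℕ → ℕ → ℕ) : Prop where
  lt : ∀ x < m, ∀ t < q, f x t < q
  agree : ∀ x < m, ∀ y < m, x ≠ y → ((Finset.range q).filter fun t => f x t = f y t).card ≤ D
  value : ∀ x < m, ∀ c, ((Finset.range q).filter fun t => f x t = c).card ≤ D

-- Numbers below `q` are distinct residues, so the points of agreement are distinct roots of `P -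
-- Q`.
open Polynomial in
theorem card_filter_eval_zmod_eq_le {q : ℕ} [Fact q.Prime] (P Q : (ZMod q)[X]) (D : ℕ)
    (hne : P ≠ Q) (hP : P.natDegree ≤ D) (hQ : Q.natDegree ≤ D) :
    ((Finset.range q).filter fun t : ℕ => P.eval (t : ZMod q) = Q.eval (t : ZMod q)).card ≤ D := by
  classical
  have h0 : P - Q ≠ 0 := sub_ne_zero.2 hne
  calc _ = (((Finset.range q).filter fun t : ℕ =>
        P.eval (t : ZMod q) = Q.eval (t : ZMod q)).image fun t : ℕ => (t : ZMod q)).card := by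
        rw [Finset.card_image_of_injOn]
        intro a ha b hb hab
        simp only [Finset.coe_filter, Finset.mem_range, Set.mem_ofPred_eq] at ha hb
        have hab : (a : ZMod q) = b := hab
        rw [ZMod.natCast_eq_natCast_iff] at hab
        exact Nat.ModEq.eq_of_lt_of_lt hab ha.1 hb.1
    _ ≤ (P - Q).roots.toFinset.card := by
        apply Finset.card_le_card
        intro z hz
        simp only [Finset.mem_image, Finset.mem_filter] at hz
        obtain ⟨t, ⟨_, ht⟩, rfl⟩ := hz
        rw [Multiset.mem_toFinset, mem_roots h0]
        simp [IsRoot, ht]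
    _ ≤ (P - Q).roots.card := Multiset.toFinset_card_le _
    _ ≤ (P - Q).natDegree := card_roots' _
    _ ≤ D := (natDegree_sub_le _ _).trans (max_le hP hQ)

open Polynomial in
/-- Monic polynomials of degree `D` over a prime field form such a family. -/
theorem exists_isCodeFamily (m q D : ℕ) (hq : q.Prime) (hD : 1 ≤ D) (hm : m ≤ q ^ D) :
    ∃ f, IsCodeFamily m q D f := by
  classical
  have : Fact q.Prime := ⟨hq⟩
  have hc : Fintype.card (Fin m) ≤ Fintype.card (Fin D → ZMod q) := by simpa [ZMod.card] using hm
  obtain ⟨φ⟩ := Function.Embedding.nonempty_of_card_le hc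
  -- The `D` free lower coefficients give `q ^ D` polynomials. The leading term keeps them from
  -- being constant, which bounds how often a value is taken.
  let P : ℕ → (ZMod q)[X] := fun x =>
    if hx : x < m then X ^ D + ∑ i : Fin D, C (φ ⟨x, hx⟩ i) * X ^ (i : ℕ) else 0
  have hcoeff : ∀ x (hx : x < m) (i : Fin D), (P x).coeff i = φ ⟨x, hx⟩ i := by
    intro x hx i
    simp only [P, hx, dif_pos, coeff_add, coeff_X_pow, finsetSum_coeff, coeff_C_mul]
    rw [if_neg i.2.ne, Finset.sum_eq_single i]
    · simp
    · intro j _ hj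
      rw [if_neg (fun h => hj (Fin.ext h.symm)), mul_zero]
    · simp
  have hlow : ∀ (x) (hx : x < m), (∑ i : Fin D, C (φ ⟨x, hx⟩ i) * X ^ (i : ℕ)).degree < (D : WithBot ℕ) := by
    intro x hx
    refine (degree_sum_le _ _).trans_lt ?_
    rw [Finset.sup_lt_iff (by exact_mod_cast WithBot.bot_lt_coe D)]
    intro i _
    exact (degree_C_mul_X_pow_le _ _).trans_lt (by exact_mod_cast i.2)
  have hmonic : ∀ x < m, (P x).Monic := by
    intro x hx
    simp only [P, hx, dif_pos]
    exact monic_X_pow_add (hlow x hx)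
  have hdeg : ∀ x < m, (P x).natDegree = D := by
    intro x hx
    simp only [P, hx, dif_pos]
    rw [add_comm, natDegree_add_eq_right_of_degree_lt (by rw [degree_X_pow]; exact hlow x hx),
      natDegree_X_pow]
  have hval : ∀ a b : ZMod q, a.val = b.val ↔ a = b := fun a b => (ZMod.val_injective q).eq_iff
  refine ⟨fun x t => ((P x).eval (t : ZMod q)).val, fun x _ t _ => ZMod.val_lt _, ?_, ?_⟩
  · intro x hx y hy hxy
    simp only [hval]
    refine card_filter_eval_zmod_eq_le _ _ _ ?_ (hdeg x hx).le (hdeg y hy).le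
    intro h
    apply hxy
    have : φ ⟨x, hx⟩ = φ ⟨y, hy⟩ := by
      funext i
      rw [← hcoeff x hx i, ← hcoeff y hy i, h]
    simpa using φ.injective this
  · intro x hx c
    by_cases hcq : c < q
    · have hcc : ∀ a : ZMod q, a.val = c ↔ a = (C (c : ZMod q)).eval (0 : ZMod q) := by
        intro a
        rw [eval_C]
        conv_lhs => rw [← ZMod.val_cast_of_lt hcq]
        exact hval _ _
      have := card_filter_eval_zmod_eq_le (P x) (C (c : ZMod q)) D ?_ (hdeg x hx).le (by simp)
      · simpa [hcc] using this
      · intro h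
        have := hdeg x hx
        rw [h, natDegree_C] at this
        omega
    · rw [Finset.filter_false_of_mem]
      · simp
      · intro t _ h
        exact hcq (h ▸ ZMod.val_lt _)

/-! ### Families of candidate subsets, by counting transversals. -/

/-- A family of sets of colors `F x S r ⊆ S` with `r < R`, for all `x < m` and all sets `S` of `l`
colors, such that against any `β` pairs `(x', S')` with `x' ≠ x` one of the sets `F x S r`
meets each of the sets `F x' S' r'` in at most `τ` colors, while it has more than `β * τ` colors. -/
structure IsListFamily {C : Type} [DecidableEq C] (m β l R τ : ℕ)
    (F : ℕ → Finset C → ℕ → Finset C) : Prop where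
  subset : ∀ x < m, ∀ S : Finset C, S.card = l → ∀ r < R, F x S r ⊆ S
  card : ∀ x < m, ∀ S : Finset C, S.card = l → ∀ r < R, β * τ < (F x S r).card
  sparse : ∀ x < m, ∀ S : Finset C, S.card = l → ∀ Y : Finset (ℕ × Finset C), Y.card ≤ β →
    (∀ y ∈ Y, y.1 < m ∧ y.2.card = l ∧ y.1 ≠ x) →
    ∃ r < R, ∀ y ∈ Y, ∀ r' < R, (F x S r ∩ F y.1 y.2 r').card ≤ τ

section ListFamily

open Finset

variable {C : Type} [DecidableEq C]

/-- The transversal of a set of `k * s` colors, arranged in `k` blocks of size `s`, that consists of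
the color with number `w j` of each block `j`. -/
def transversal {k s : ℕ} (e : Fin k × Fin s ↪ C) (w : Fin k → Fin s) : Finset C :=
  univ.image fun j => e (j, w j)

theorem card_transversal {k s : ℕ} (e : Fin k × Fin s ↪ C) (w : Fin k → Fin s) :
    (transversal e w).card = k := by
  unfold transversal
  rw [card_image_of_injective, card_univ, Fintype.card_fin]
  intro a b h
  exact congrArg Prod.fst (e.injective h)

/-- Each element of `D` forces the choice in its own block. If two elements share a block, or one
lies in no block, no transversal contains `D`. -/
theorem card_superset_transversal_le {k s : ℕ} (e : Fin k × Fin s ↪ C) (D : Finset C) :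
    (univ.filter fun w : Fin k → Fin s => D ⊆ transversal e w).card * s ^ D.card ≤ s ^ k := by
  classical
  rcases (univ.filter fun w : Fin k → Fin s => D ⊆ transversal e w).eq_empty_or_nonempty with h | h
  · simp [h]
  obtain ⟨w₀, hw₀⟩ := h
  simp only [mem_filter, mem_univ, true_and] at hw₀
  set J : Finset (Fin k) := univ.filter fun j => e (j, w₀ j) ∈ D with hJ
  have hinj : Function.Injective fun j => e (j, w₀ j) :=
    fun a b h => congrArg Prod.fst (e.injective h)
  have hJD : J.card = D.card := by
    rw [← card_image_of_injective J hinj]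
    congr 1
    ext d
    simp only [mem_image, hJ, mem_filter, mem_univ, true_and]
    constructor
    · rintro ⟨j, hj, rfl⟩; exact hj
    · intro hd
      have := hw₀ hd
      simp only [transversal, mem_image, mem_univ, true_and] at this
      obtain ⟨j, rfl⟩ := this
      exact ⟨j, hd, rfl⟩
  have hsub : (univ.filter fun w : Fin k → Fin s => D ⊆ transversal e w) ⊆
      Fintype.piFinset fun j => if j ∈ J then {w₀ j} else univ := by
    intro w hw
    simp only [mem_filter, mem_univ, true_and] at hw
    rw [Fintype.mem_piFinset]
    intro j
    split_ifs with hj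
    · simp only [hJ, mem_filter, mem_univ, true_and] at hj
      have := hw hj
      simp only [transversal, mem_image, mem_univ, true_and] at this
      obtain ⟨j', h'⟩ := this
      have h2 := e.injective h'
      rw [Prod.mk.injEq] at h2
      obtain ⟨rfl, h3⟩ := h2
      simpa using h3
    · simp
  have hprod : (∏ j : Fin k, (if j ∈ J then ({w₀ j} : Finset (Fin s)) else univ).card) =
      s ^ (k - J.card) := by
    have : ∀ j : Fin k, (if j ∈ J then ({w₀ j} : Finset (Fin s)) else univ).card =
        if j ∈ J then 1 else s := by
      intro j
      split_ifs <;> simp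
    simp only [this]
    rw [prod_ite, prod_const_one, one_mul, prod_const]
    congr 1
    rw [filter_not, card_sdiff_of_subset (filter_subset _ _), card_univ, Fintype.card_fin]
    congr 2
    ext; simp
  have hJk : J.card ≤ k := by simpa using card_le_univ J
  calc _ ≤ s ^ (k - J.card) * s ^ D.card := by
        refine Nat.mul_le_mul_right _ ((card_le_card hsub).trans ?_)
        rw [Fintype.card_piFinset, hprod]
    _ = s ^ k := by rw [← hJD, ← pow_add, Nat.sub_add_cancel hJk]

/-- Union bound over the `σ`-subsets of `S` that the transversal could contain. -/
theorem card_large_inter_transversal_le {k s : ℕ} (e : Fin k × Fin s ↪ C) (S : Finset C) (σ : ℕ) :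
    (univ.filter fun w : Fin k → Fin s => σ ≤ (transversal e w ∩ S).card).card * s ^ σ ≤
      S.card.choose σ * s ^ k := by
  classical
  have hsub : (univ.filter fun w : Fin k → Fin s => σ ≤ (transversal e w ∩ S).card) ⊆
      (S.powersetCard σ).biUnion fun D => univ.filter fun w => D ⊆ transversal e w := by
    intro w hw
    simp only [mem_filter, mem_univ, true_and] at hw
    obtain ⟨D, hD, hc⟩ := exists_subset_card_eq hw
    simp only [mem_biUnion, mem_powersetCard, mem_filter, mem_univ, true_and]
    exact ⟨D, ⟨hD.trans inter_subset_right, hc⟩, hD.trans inter_subset_left⟩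
  calc _ ≤ (∑ D ∈ S.powersetCard σ,
          (univ.filter fun w : Fin k → Fin s => D ⊆ transversal e w).card) * s ^ σ :=
        Nat.mul_le_mul_right _ ((card_le_card hsub).trans card_biUnion_le)
    _ = ∑ D ∈ S.powersetCard σ,
          (univ.filter fun w : Fin k → Fin s => D ⊆ transversal e w).card * s ^ σ := sum_mul ..
    _ ≤ ∑ D ∈ S.powersetCard σ, s ^ k := by
        refine sum_le_sum fun D hD => ?_
        have h := card_superset_transversal_le (s := s) e D
        rwa [(mem_powersetCard.1 hD).2] at h
    _ = _ := by rw [sum_const, card_powersetCard, smul_eq_mul]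

theorem card_hit_transversal_le {k s R : ℕ} (e : Fin k × Fin s ↪ C) (S : Fin R → Finset C)
    (hS : ∀ r, (S r).card = k) (σ : ℕ) :
    (univ.filter fun w : Fin k → Fin s => ∃ r, σ ≤ (transversal e w ∩ S r).card).card * s ^ σ ≤
      R * k.choose σ * s ^ k := by
  classical
  have hsub : (univ.filter fun w : Fin k → Fin s => ∃ r, σ ≤ (transversal e w ∩ S r).card) ⊆
      univ.biUnion fun r => univ.filter fun w => σ ≤ (transversal e w ∩ S r).card := by
    intro w hw
    simpa using hw
  calc _ ≤ (∑ r : Fin R, (univ.filter fun w : Fin k → Fin s =>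
          σ ≤ (transversal e w ∩ S r).card).card) * s ^ σ :=
        Nat.mul_le_mul_right _ ((card_le_card hsub).trans card_biUnion_le)
    _ = ∑ r : Fin R, (univ.filter fun w : Fin k → Fin s =>
          σ ≤ (transversal e w ∩ S r).card).card * s ^ σ := sum_mul ..
    _ ≤ ∑ r : Fin R, k.choose σ * s ^ k := by
        refine sum_le_sum fun r _ => ?_
        have h := card_large_inter_transversal_le (s := s) e (S r) σ
        rwa [hS r] at h
    _ = _ := by rw [sum_const, card_univ, Fintype.card_fin, smul_eq_mul, mul_assoc]

/-- Union bound over the `g` coordinates required to lie in `H`. Demanding many hits makes the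
probability a `g`-th power, small enough to beat the number of pairs of lists. -/
theorem card_many_hits_le {α : Type} [Fintype α] [DecidableEq α] (H : Finset α) (R g : ℕ) :
    (univ.filter fun a : Fin R → α => g ≤ (univ.filter fun r => a r ∈ H).card).card ≤
      R.choose g * (H.card ^ g * Fintype.card α ^ (R - g)) := by
  classical
  have hsub : (univ.filter fun a : Fin R → α => g ≤ (univ.filter fun r => a r ∈ H).card) ⊆
      ((univ : Finset (Fin R)).powersetCard g).biUnion fun J =>
        Fintype.piFinset fun r => if r ∈ J then H else univ := by
    intro a ha
    simp only [mem_filter, mem_univ, true_and] at ha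
    obtain ⟨J, hJ, hc⟩ := exists_subset_card_eq ha
    simp only [mem_biUnion, mem_powersetCard, subset_univ, true_and, Fintype.mem_piFinset]
    refine ⟨J, hc, fun r => ?_⟩
    split_ifs with h
    · simpa using hJ h
    · simp
  calc _ ≤ ∑ J ∈ (univ : Finset (Fin R)).powersetCard g,
          (Fintype.piFinset fun r => if r ∈ J then H else univ).card :=
        (card_le_card hsub).trans card_biUnion_le
    _ = ∑ J ∈ (univ : Finset (Fin R)).powersetCard g, H.card ^ g * Fintype.card α ^ (R - g) := by
        refine sum_congr rfl fun J hJ => ?_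
        rw [mem_powersetCard] at hJ
        rw [Fintype.card_piFinset]
        have : ∀ r : Fin R, (if r ∈ J then H else univ).card =
            if r ∈ J then H.card else Fintype.card α := by
          intro r
          split_ifs <;> simp
        simp only [this]
        rw [prod_ite, prod_const, prod_const]
        congr 2
        · rw [← hJ.2]; congr 1; ext; simp
        · rw [filter_not, card_sdiff_of_subset (filter_subset _ _), card_univ, Fintype.card_fin,
            ← hJ.2]
          congr 2; ext; simp
    _ = _ := by simp [sum_const, card_powersetCard]

/-- If for every pair of indices only a small fraction of the choices at the first index is bad
for a given choice at the second, then there is a choice without bad pairs. -/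
theorem exists_forall_not_bad {ι A : Type} [Fintype ι] [DecidableEq ι] [Fintype A] [Nonempty A]
    (bad : ι → A → ι → A → Prop) [∀ i a j b, Decidable (bad i a j b)] (Z : ℕ)
    (hZ : Fintype.card ι ^ 2 < Z)
    (h : ∀ i j, i ≠ j → ∀ b, (univ.filter fun a => bad i a j b).card * Z ≤ Fintype.card A) :
    ∃ f : ι → A, ∀ i j, i ≠ j → ¬ bad i (f i) j (f j) := by
  classical
  by_contra hcon
  push Not at hcon
  have hpair : ∀ i j, i ≠ j →
      (univ.filter fun f : ι → A => bad i (f i) j (f j)).card * Z ≤ Fintype.card (ι → A) := by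
    intro i j hij
    -- With all choices except the one at `i` fixed, the choice at `j` is a constant, so the
    -- hypothesis applies to each fiber.
    let E := Equiv.funSplitAt i A
    have h1 : (univ.filter fun f : ι → A => bad i (f i) j (f j)).card =
        ∑ f' : {j // j ≠ i} → A, (univ.filter fun a => bad i a j (f' ⟨j, hij.symm⟩)).card := by
      rw [← card_sigma]
      refine card_bij' (fun f _ => ⟨(E f).2, (E f).1⟩) (fun x _ => E.symm (x.2, x.1)) ?_ ?_ ?_ ?_
      · intro f hf
        simpa [E, Equiv.funSplitAt, Equiv.piSplitAt] using hf
      · intro x hx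
        simpa [E, Equiv.funSplitAt, Equiv.piSplitAt, hij.symm] using hx
      · intro f _; simp
      · intro x _; simp
    rw [h1, sum_mul]
    calc _ ≤ ∑ f' : {j // j ≠ i} → A, Fintype.card A := sum_le_sum fun f' _ => h i j hij _
      _ = Fintype.card (A × ({j // j ≠ i} → A)) := by
        rw [sum_const, card_univ, smul_eq_mul, Fintype.card_prod, mul_comm]
      _ = _ := (Fintype.card_congr E).symm
  have hcover : (univ : Finset (ι → A)) ⊆ (univ : Finset (ι × ι)).biUnion fun ij =>
      univ.filter fun f : ι → A => ij.1 ≠ ij.2 ∧ bad ij.1 (f ij.1) ij.2 (f ij.2) := by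
    intro f _
    obtain ⟨i, j, hij, hb⟩ := hcon f
    simp only [mem_biUnion, mem_filter, mem_univ, true_and]
    exact ⟨(i, j), hij, hb⟩
  have hpos : 0 < Fintype.card (ι → A) := Fintype.card_pos
  have : Fintype.card (ι → A) * Z ≤ Fintype.card ι ^ 2 * Fintype.card (ι → A) := by
    calc Fintype.card (ι → A) * Z ≤ (∑ ij : ι × ι, (univ.filter fun f : ι → A =>
          ij.1 ≠ ij.2 ∧ bad ij.1 (f ij.1) ij.2 (f ij.2)).card) * Z :=
          Nat.mul_le_mul_right _ ((card_le_card hcover).trans card_biUnion_le)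
      _ ≤ ∑ ij : ι × ι, Fintype.card (ι → A) := by
          rw [sum_mul]
          refine sum_le_sum fun ij _ => ?_
          by_cases hij : ij.1 = ij.2
          · simp [hij]
          · simpa [hij] using hpair ij.1 ij.2 hij
      _ = _ := by rw [sum_const, card_univ, Fintype.card_prod, smul_eq_mul, sq]
  rw [mul_comm] at this
  exact absurd (Nat.le_of_mul_le_mul_right this hpos) (by omega)

/-- Every pair of color and arranged list chooses `R` transversals of size `β * τ + 1`. By `hnum`, a
fraction at most `1 / Z` of these choices has `g` transversals that meet some transversal of a given
other pair in more than `τ` colors. By `hZ`, some choice avoids this for all pairs at once. Each of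
`β` opponents then spoils at most `g - 1` of the `R` candidates, and `hkill` leaves one. -/
theorem exists_isListFamily [Fintype C] (m β τ s R g Z : ℕ) (hs : 0 < s) (hgR : g ≤ R)
    (hkill : β * (g - 1) < R) (hg : 0 < g)
    (hZ : (m * Fintype.card C ^ ((β * τ + 1) * s)) ^ 2 < Z)
    (hnum : R.choose g * (R * (β * τ + 1).choose (τ + 1)) ^ g * Z ≤ (s ^ (τ + 1)) ^ g) :
    ∃ F : ℕ → Finset C → ℕ → Finset C, IsListFamily m β ((β * τ + 1) * s) R τ F := by
  classical
  set k := β * τ + 1 with hk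
  have hne : Nonempty (Fin s) := ⟨⟨0, hs⟩⟩
  -- Lists enter as arrangements into blocks; there are at most `|C| ^ (k * s)` of them.
  let ι := Fin m × (Fin k × Fin s ↪ C)
  let A := Fin R → Fin k → Fin s
  let hits : ι → (Fin k → Fin s) → ι → A → Prop := fun i w j b =>
    ∃ r, τ + 1 ≤ (transversal i.2 w ∩ transversal j.2 (b r)).card
  obtain ⟨f, hf⟩ := exists_forall_not_bad (ι := ι) (A := A)
    (fun i a j b => g ≤ (univ.filter fun r => hits i (a r) j b).card) Z
    (by
      refine lt_of_le_of_lt (Nat.pow_le_pow_left ?_ 2) hZ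
      rw [Fintype.card_prod, Fintype.card_fin, Fintype.card_embedding_eq, Fintype.card_prod,
        Fintype.card_fin, Fintype.card_fin]
      exact Nat.mul_le_mul_left _ (Nat.descFactorial_le_pow _ _))
    (by
      intro i j _ b
      set H : Finset (Fin k → Fin s) := univ.filter fun w => hits i w j b with hH
      have h1 : H.card * s ^ (τ + 1) ≤ R * k.choose (τ + 1) * s ^ k :=
        card_hit_transversal_le i.2 (fun r => transversal j.2 (b r))
          (fun r => card_transversal _ _) (τ + 1)
      have h2 := card_many_hits_le H R g
      have h3 : (univ.filter fun a : A => g ≤ (univ.filter fun r => hits i (a r) j b).card) =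
          univ.filter fun a : A => g ≤ (univ.filter fun r => a r ∈ H).card := by
        simp [hH]
      rw [h3]
      have hα : Fintype.card (Fin k → Fin s) = s ^ k := by simp
      have hA : Fintype.card A = (s ^ k) ^ g * (s ^ k) ^ (R - g) := by
        rw [← pow_add, Nat.add_sub_cancel' hgR]
        simp [A]
      rw [hα] at h2
      rw [hA]
      have hsp : 0 < (s ^ (τ + 1)) ^ g := by positivity
      have h4 : R.choose g * H.card ^ g * Z ≤ (s ^ k) ^ g := by
        refine Nat.le_of_mul_le_mul_right ?_ hsp
        calc R.choose g * H.card ^ g * Z * (s ^ (τ + 1)) ^ g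
            = R.choose g * Z * (H.card * s ^ (τ + 1)) ^ g := by rw [mul_pow]; ring
          _ ≤ R.choose g * Z * (R * k.choose (τ + 1) * s ^ k) ^ g := by gcongr
          _ = R.choose g * (R * k.choose (τ + 1)) ^ g * Z * (s ^ k) ^ g := by
              rw [mul_pow (R * k.choose (τ + 1))]; ring
          _ ≤ (s ^ (τ + 1)) ^ g * (s ^ k) ^ g := Nat.mul_le_mul_right _ hnum
          _ = _ := by ring
      calc _ ≤ R.choose g * (H.card ^ g * (s ^ k) ^ (R - g)) * Z := Nat.mul_le_mul_right _ h2
        _ = R.choose g * H.card ^ g * Z * (s ^ k) ^ (R - g) := by ring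
        _ ≤ _ := Nat.mul_le_mul_right _ h4)
  let emb : (S : Finset C) → S.card = k * s → (Fin k × Fin s ↪ C) := fun S hS =>
    (finProdFinEquiv.trans (S.equivFinOfCardEq hS).symm).toEmbedding.trans
      (Function.Embedding.subtype _)
  have hemb : ∀ S hS x, emb S hS x ∈ S := fun S hS x =>
    ((S.equivFinOfCardEq hS).symm (finProdFinEquiv x)).2
  let F : ℕ → Finset C → ℕ → Finset C := fun x S r =>
    if h : x < m ∧ S.card = k * s ∧ r < R then
      transversal (emb S h.2.1) (f (⟨x, h.1⟩, emb S h.2.1) ⟨r, h.2.2⟩) else ∅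
  have hF : ∀ x (hx : x < m) S (hS : S.card = k * s) r (hr : r < R),
      F x S r = transversal (emb S hS) (f (⟨x, hx⟩, emb S hS) ⟨r, hr⟩) := by
    intro x hx S hS r hr
    simp only [F]
    rw [dif_pos ⟨hx, hS, hr⟩]
  refine ⟨F, ⟨?_, ?_, ?_⟩⟩
  · intro x hx S hS r hr
    rw [hF x hx S hS r hr]
    intro c hc
    simp only [transversal, mem_image, mem_univ, true_and] at hc
    obtain ⟨j, rfl⟩ := hc
    exact hemb S hS _
  · intro x hx S hS r hr
    rw [hF x hx S hS r hr, card_transversal, hk]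
    omega
  · intro x hx S hS Y hY hYm
    let kill : ℕ × Finset C → Finset (Fin R) := fun y =>
      univ.filter fun r : Fin R => ∃ r' < R, τ + 1 ≤ (F x S r ∩ F y.1 y.2 r').card
    have hkillc : ∀ y ∈ Y, (kill y).card ≤ g - 1 := by
      intro y hy
      obtain ⟨hy1, hy2, hy3⟩ := hYm y hy
      have := hf (⟨x, hx⟩, emb S hS) (⟨y.1, hy1⟩, emb y.2 hy2)
        (fun h => hy3 (congrArg (fun z : ι => (z.1 : ℕ)) h).symm)
      have hle : (kill y).card ≤ (univ.filter fun r => hits (⟨x, hx⟩, emb S hS)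
          (f (⟨x, hx⟩, emb S hS) r) (⟨y.1, hy1⟩, emb y.2 hy2)
          (f (⟨y.1, hy1⟩, emb y.2 hy2))).card := by
        apply card_le_card
        intro r hr
        simp only [kill, mem_filter, mem_univ, true_and] at hr ⊢
        obtain ⟨r', hr', h⟩ := hr
        rw [hF x hx S hS r r.2, hF y.1 hy1 y.2 hy2 r' hr'] at h
        exact ⟨⟨r', hr'⟩, h⟩
      omega
    have hU : (Y.biUnion kill).card < (univ : Finset (Fin R)).card := by
      rw [card_univ, Fintype.card_fin]
      calc _ ≤ ∑ y ∈ Y, (kill y).card := card_biUnion_le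
        _ ≤ ∑ y ∈ Y, (g - 1) := sum_le_sum hkillc
        _ = Y.card * (g - 1) := by rw [sum_const, smul_eq_mul]
        _ ≤ β * (g - 1) := Nat.mul_le_mul_right _ hY
        _ < R := hkill
    obtain ⟨r, -, hr⟩ := exists_mem_notMem_of_card_lt_card hU
    refine ⟨r, r.2, fun y hy r' hr' => ?_⟩
    by_contra hc
    apply hr
    simp only [mem_biUnion, kill, mem_filter, mem_univ, true_and]
    exact ⟨y, hy, r', hr', by omega⟩

end ListFamily

/-! ### One stage of the coloring algorithm. -/

theorem runRound_eq {C V : Type} [Fintype V] {G : SimpleGraph V} [DecidableRel G.Adj]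
    {L : V → Finset C} {M : ℕ} {s : V → NodeState C} {r : RoundRule C} {v : V}
    (h : r (L v) (s v) ((G.neighborFinset v).val.map s) = s v ∨
      IsLegal M (L v) (s v) (r (L v) (s v) ((G.neighborFinset v).val.map s))) :
    runRound M G L s r v = r (L v) (s v) ((G.neighborFinset v).val.map s) := by
  unfold runRound advance
  split_ifs with h'
  · rfl
  · rcases h with h | h
    · exact h.symm
    · exact absurd h h'

theorem card_filter_map_val {V α : Type} (N : Finset V) (s : V → α) (P : α → Prop)
    [DecidablePred P] :
    ((N.val.map s).filter P).card = (N.filter fun u => P (s u)).card := by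
  rw [Multiset.filter_map, Multiset.card_map]
  rfl

section Coloring

open Classical

variable {C : Type} [Nonempty C]

/-- The color with number `j` of a set of colors. -/
noncomputable def nthColor (S : Finset C) (j : ℕ) : C :=
  if h : j < S.card then (S.equivFin.symm ⟨j, h⟩ : C) else Classical.arbitrary C

theorem nthColor_mem {S : Finset C} {j : ℕ} (h : j < S.card) : nthColor S j ∈ S := by
  rw [nthColor, dif_pos h]
  exact (S.equivFin.symm ⟨j, h⟩).2

theorem exists_nthColor_eq {S : Finset C} {a : C} (h : a ∈ S) :
    ∃ j < S.card, nthColor S j = a := by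
  refine ⟨S.equivFin ⟨a, h⟩, Fin.is_lt _, ?_⟩
  rw [nthColor, dif_pos (Fin.is_lt _)]
  simp

/-- The color that a node has chosen from its palette. -/
noncomputable def NodeState.chosen (x : NodeState C) : C := nthColor x.palette x.vars.index

/-- The colors of a list that no neighbor has chosen for good (status `3`). -/
noncomputable def available (L : Finset C) (nbrs : Multiset (NodeState C)) : Finset C :=
  L.filter fun a => ∀ y ∈ nbrs, y.vars.status = 3 → y.chosen ≠ a

/-- An undecided node (status `0`) joins the class `f x t` and gets status `1`, if this causes at
most `β` conflicts. -/
noncomputable def assignRule (f : ℕ → ℕ → ℕ) (β t : ℕ) : RoundRule C := fun _ s nbrs =>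
  if s.vars.status = 0 ∧ (nbrs.filter fun y =>
      (y.vars.status = 0 ∧ f y.vars.color t = f s.vars.color t) ∨
      (y.vars.status = 1 ∧ y.vars.cls = f s.vars.color t)).card ≤ β then
    ⟨{ s.vars with status := 1, cls := f s.vars.color t, time := t }, s.palette⟩
  else s

/-- A node of class `c` with at least `l` available colors publishes `l` of them. -/
noncomputable def publishRule (l c : ℕ) : RoundRule C := fun L s nbrs =>
  if h : s.vars.status = 1 ∧ s.vars.cls = c ∧ l ≤ (available L nbrs).card then
    ⟨s.vars, (Finset.exists_subset_card_eq h.2.2).choose⟩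
  else s

/-- A node of class `c` picks a subset of its palette that has few colors in common with those that
its relevant neighbors can pick, and gets status `2`. -/
noncomputable def pickRule (F : ℕ → Finset C → ℕ → Finset C) (R τ c : ℕ) : RoundRule C :=
  fun _ s nbrs =>
  if h : (s.vars.status = 1 ∧ s.vars.cls = c ∧ s.palette.Nonempty) ∧ ∃ r < R, ∀ y ∈ nbrs,
      y.vars.status = 1 → y.vars.cls = c → y.palette.Nonempty → y.vars.time ≤ s.vars.time →
      ∀ r' < R, (F s.vars.color s.palette r ∩ F y.vars.color y.palette r').card ≤ τ then
    ⟨{ s.vars with status := 2, index := h.2.choose }, s.palette⟩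
  else s

/-- A node with status `2` chooses a color from the subset it has picked that is not in the subsets
of its relevant neighbors, and gets status `3`. -/
noncomputable def finishRule (F : ℕ → Finset C → ℕ → Finset C) : RoundRule C := fun _ s nbrs =>
  if h : s.vars.status = 2 ∧ ∃ j < s.palette.card,
      nthColor s.palette j ∈ F s.vars.color s.palette s.vars.index ∧ ∀ y ∈ nbrs,
      y.vars.status = 2 → y.vars.time ≤ s.vars.time →
      nthColor s.palette j ∉ F y.vars.color y.palette y.vars.index then
    ⟨{ s.vars with status := 3, index := h.2.choose }, s.palette⟩
  else s

/-- Nodes that have not chosen a color become undecided again. -/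
def resetRule : RoundRule C := fun _ s _ =>
  if s.vars.status = 1 then ⟨{ s.vars with status := 0 }, s.palette⟩ else s

/-- The three rounds in which the nodes of class `c` choose their colors. -/
noncomputable def classRules (F : ℕ → Finset C → ℕ → Finset C) (l R τ c : ℕ) :
    List (RoundRule C) :=
  [publishRule l c, pickRule F R τ c, finishRule F]

/-- One stage of the coloring algorithm. -/
noncomputable def stageRules (f : ℕ → ℕ → ℕ) (F : ℕ → Finset C → ℕ → Finset C)
    (β q l R τ : ℕ) : List (RoundRule C) :=
  (List.range q).map (assignRule f β) ++
    (List.range q).flatMap (classRules F l R τ) ++ [resetRule]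

theorem length_stageRules (f : ℕ → ℕ → ℕ) (F : ℕ → Finset C → ℕ → Finset C) (β q l R τ : ℕ) :
    (stageRules f F β q l R τ).length = 4 * q + 1 := by
  simp [stageRules, classRules, List.length_flatMap]
  ring

variable {V : Type} [Fintype V] (G : SimpleGraph V) [DecidableRel G.Adj] (L : V → Finset C)

/-- The number of neighbors that have not chosen a color yet. -/
noncomputable def uncoloredDegree (s : V → NodeState C) (v : V) : ℕ :=
  ((G.neighborFinset v).filter fun u => (s u).vars.status ≠ 3).card

/-- The numbers in the states are bounded, the nodes are properly colored from `{0, ..., m - 1}`,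
and the chosen colors form a partial list coloring. -/
structure Consistent (M m : ℕ) (s : V → NodeState C) : Prop where
  bounded : ∀ v, (s v).vars.Bounded M
  color_lt : ∀ v, (s v).vars.color < m
  color_ne : ∀ u v, G.Adj u v → (s u).vars.color ≠ (s v).vars.color
  index_lt : ∀ v, (s v).vars.status = 3 → (s v).vars.index < (s v).palette.card
  palette_subset : ∀ v, (s v).vars.status = 3 → (s v).palette ⊆ L v
  chosen_ne : ∀ u v, G.Adj u v → (s u).vars.status = 3 → (s v).vars.status = 3 →
    (s u).chosen ≠ (s v).chosen
  palette_empty : ∀ v, (s v).vars.status ≠ 3 → (s v).palette = ∅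

variable {G L}

/-- Each colored neighbor blocks at most one color of a list that is larger than the degree. This
turns a shortage of available colors into a bound on the uncolored degree. -/
theorem uncoloredDegree_add_one_le {s : V → NodeState C} {v : V}
    (hL : G.degree v + 1 ≤ (L v).card) :
    uncoloredDegree G s v + 1 ≤ (available (L v) ((G.neighborFinset v).val.map s)).card := by
  have hsub : L v ⊆ available (L v) ((G.neighborFinset v).val.map s) ∪
      ((G.neighborFinset v).filter fun u => ¬ (s u).vars.status ≠ 3).image fun u => (s u).chosen := by
    intro a ha
    rw [Finset.mem_union]
    by_cases h : a ∈ available (L v) ((G.neighborFinset v).val.map s)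
    · exact Or.inl h
    · right
      simp only [available, Finset.mem_filter, ha, true_and, not_forall] at h
      obtain ⟨y, hy, hy3, hne⟩ := h
      obtain ⟨u, hu, rfl⟩ := Multiset.mem_map.1 hy
      simp only [Finset.mem_image, Finset.mem_filter]
      exact ⟨u, ⟨hu, not_not.2 hy3⟩, not_not.1 hne⟩
  have h1 := (Finset.card_le_card hsub).trans (Finset.card_union_le _ _)
  have h2 := Finset.card_image_le (s := (G.neighborFinset v).filter fun u => ¬ (s u).vars.status ≠ 3)
    (f := fun u => (s u).chosen)
  have h3 := Finset.card_filter_add_card_filter_not (s := G.neighborFinset v)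
    (fun u => (s u).vars.status ≠ 3)
  rw [G.card_neighborFinset_eq_degree] at h3
  unfold uncoloredDegree
  omega

section Assign

variable {f : ℕ → ℕ → ℕ} {β δ q m M D : ℕ}

/-- The state of affairs after `t` rounds of class assignment. -/
structure AssignInvariant (G : SimpleGraph V) [DecidableRel G.Adj] (L : V → Finset C)
    (f : ℕ → ℕ → ℕ) (M m δ β q t : ℕ) (s : V → NodeState C) : Prop
    extends Consistent G L M m s where
  status : ∀ v, (s v).vars.status = 0 ∨ (s v).vars.status = 1 ∨ (s v).vars.status = 3
  degree_le : ∀ v, (s v).vars.status ≠ 3 → uncoloredDegree G s v ≤ δ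
  assigned : ∀ v, (s v).vars.status = 1 → (s v).vars.cls < q ∧ (s v).vars.time < t ∧
    ((G.neighborFinset v).filter fun u => (s u).vars.status = 1 ∧
      (s u).vars.cls = (s v).vars.cls ∧ (s u).vars.time ≤ (s v).vars.time).card ≤ β
  undecided : ∀ v, (s v).vars.status = 0 → ∀ t' < t, β <
    ((G.neighborFinset v).filter fun u => (s u).vars.status ≠ 3 ∧
      (f (s u).vars.color t' = f (s v).vars.color t' ∨
        (s u).vars.status = 1 ∧ (s u).vars.cls = f (s v).vars.color t')).card

/-- Joining times orient the conflicts: a node answers only for neighbors that joined its class no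
later than itself, and these are counted in the test at the moment it joins. -/
theorem AssignInvariant.succ (hf : IsCodeFamily m q D f) (hM : q + 4 ≤ M) {t : ℕ} (ht : t < q)
    {s : V → NodeState C} (h : AssignInvariant G L f M m δ β q t s) :
    AssignInvariant G L f M m δ β q (t + 1) (runRound M G L s (assignRule f β t)) := by
  set P : V → Prop := fun v => (s v).vars.status = 0 ∧ ((G.neighborFinset v).filter fun u =>
      ((s u).vars.status = 0 ∧ f (s u).vars.color t = f (s v).vars.color t) ∨
      ((s u).vars.status = 1 ∧ (s u).vars.cls = f (s v).vars.color t)).card ≤ β with hP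
  have hs : ∀ v, runRound M G L s (assignRule f β t) v = if P v then
      ⟨{ (s v).vars with status := 1, cls := f (s v).vars.color t, time := t }, (s v).palette⟩
      else s v := by
    intro v
    have hr : assignRule f β t (L v) (s v) ((G.neighborFinset v).val.map s) = if P v then
      ⟨{ (s v).vars with status := 1, cls := f (s v).vars.color t, time := t }, (s v).palette⟩
      else s v := by
      simp only [assignRule, card_filter_map_val, hP]
    rw [runRound_eq, hr]
    rw [hr]
    split_ifs with hv
    · refine Or.inr (Or.inl ⟨rfl, ?_⟩)
      have := h.bounded v
      have h2 := hf.lt _ (h.color_lt v) t ht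
      exact ⟨this.1, by simp; omega, by simp; omega, by simp; omega, this.2.2.2.2⟩
    · exact Or.inl rfl
  set s' := runRound M G L s (assignRule f β t) with hs'
  have hcol : ∀ v, (s' v).vars.color = (s v).vars.color := fun v => by rw [hs]; split_ifs <;> rfl
  have hpal : ∀ v, (s' v).palette = (s v).palette := fun v => by rw [hs]; split_ifs <;> rfl
  have hpos : ∀ v, P v → (s' v).vars.status = 1 ∧ (s' v).vars.cls = f (s v).vars.color t ∧
      (s' v).vars.time = t := fun v hv => by rw [hs, if_pos hv]; exact ⟨rfl, rfl, rfl⟩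
  have hneg : ∀ v, ¬ P v → s' v = s v := fun v hv => by rw [hs, if_neg hv]
  have hbdd : ∀ v, (s' v).vars.Bounded M := by
    intro v
    have := h.bounded v
    by_cases hv : P v
    · have h2 := hf.lt _ (h.color_lt v) t ht
      rw [hs, if_pos hv]
      exact ⟨this.1, by simp; omega, by simp; omega, by simp; omega, this.2.2.2.2⟩
    · rw [hneg v hv]; exact this
  have h3 : ∀ v, (s' v).vars.status = 3 → s' v = s v := by
    intro v hv
    by_cases hPv : P v
    · have := (hpos v hPv).1; omega
    · exact hneg v hPv
  have h3' : ∀ v, (s' v).vars.status = 3 ↔ (s v).vars.status = 3 := by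
    intro v
    by_cases hPv : P v
    · have := (hpos v hPv).1
      have := hPv.1
      omega
    · rw [hneg v hPv]
  have hunc : ∀ v, uncoloredDegree G s' v = uncoloredDegree G s v := by
    intro v
    unfold uncoloredDegree
    simp only [ne_eq, h3']
  refine ⟨⟨hbdd, fun v => by rw [hcol]; exact h.color_lt v,
    fun u v huv => by rw [hcol, hcol]; exact h.color_ne u v huv, ?_, ?_, ?_, ?_⟩, ?_, ?_, ?_, ?_⟩
  · intro v hv
    have ev := h3 v hv
    rw [ev] at hv ⊢
    exact h.index_lt v hv
  · intro v hv
    have ev := h3 v hv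
    rw [ev] at hv ⊢
    exact h.palette_subset v hv
  · intro u v huv hu hv
    have ev := h3 v hv
    have eu := h3 u hu
    rw [ev] at hv ⊢
    rw [eu] at hu ⊢
    exact h.chosen_ne u v huv hu hv
  · intro v hv
    rw [hpal]
    exact h.palette_empty v (by rwa [ne_eq, ← h3'])
  · intro v
    by_cases hPv : P v
    · exact Or.inr (Or.inl (hpos v hPv).1)
    · rw [hneg v hPv]; exact h.status v
  · intro v hv
    rw [hunc]
    exact h.degree_le v (by rwa [ne_eq, ← h3'])
  · intro v hv
    by_cases hPv : P v
    · obtain ⟨-, h2, h4⟩ := hpos v hPv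
      rw [h2, h4]
      refine ⟨hf.lt _ (h.color_lt v) t ht, by omega, le_trans (Finset.card_le_card ?_) hPv.2⟩
      intro u hu
      simp only [Finset.mem_filter] at hu ⊢
      refine ⟨hu.1, ?_⟩
      by_cases hPu : P u
      · exact Or.inl ⟨hPu.1, by rw [← (hpos u hPu).2.1]; exact hu.2.2.1⟩
      · rw [hneg u hPu] at hu
        exact Or.inr ⟨hu.2.1, hu.2.2.1⟩
    · rw [hneg v hPv] at hv ⊢
      obtain ⟨h1, h2, h4⟩ := h.assigned v hv
      refine ⟨h1, by omega, le_trans (Finset.card_le_card ?_) h4⟩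
      intro u hu
      simp only [Finset.mem_filter] at hu ⊢
      -- A node joining now has time `t`, which exceeds the time of `v`, so it adds no conflict to
      -- `v`.
      by_cases hPu : P u
      · have := (hpos u hPu).2.2
        omega
      · rw [hneg u hPu] at hu
        exact hu
  · intro v hv t' ht'
    have hPv : ¬ P v := fun hPv => by have := (hpos v hPv).1; omega
    rw [hneg v hPv] at hv ⊢
    rcases Nat.lt_succ_iff_lt_or_eq.1 ht' with h1 | rfl
    -- Old conflicts persist: colors do not change, no node gets status `3`, and assigned nodes keep
    -- their class.
    · refine lt_of_lt_of_le (h.undecided v hv t' h1) (Finset.card_le_card ?_)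
      intro u hu
      simp only [Finset.mem_filter, ne_eq, h3', hcol] at hu ⊢
      refine ⟨hu.1, hu.2.1, hu.2.2.imp_right fun hu2 => ?_⟩
      have hPu : ¬ P u := fun hPu => by have := hPu.1; omega
      rwa [hneg u hPu]
    · have h1 : β < _ := lt_of_not_ge fun hle => hPv ⟨hv, hle⟩
      refine lt_of_lt_of_le h1 (Finset.card_le_card ?_)
      intro u hu
      simp only [Finset.mem_filter, ne_eq, h3', hcol] at hu ⊢
      refine ⟨hu.1, ?_⟩
      rcases hu.2 with hu2 | hu2
      · exact ⟨by omega, Or.inl hu2.2⟩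
      · have hPu : ¬ P u := fun hPu => by have := hPu.1; omega
        rw [hneg u hPu]
        exact ⟨by omega, Or.inr hu2⟩

/-- Double counting: a node undecided throughout has at least `β + 1` conflicts in each of `q`
rounds. A neighbor contributes at most `2 * D` of them, `D` by agreement of the two functions and
`D` because the function of the node hits the neighbor's fixed class. -/
theorem AssignInvariant.decided (hf : IsCodeFamily m q D f) (hq : 2 * D * δ < q * (β + 1))
    {s : V → NodeState C} (h : AssignInvariant G L f M m δ β q q s) (v : V) :
    (s v).vars.status ≠ 0 := by
  intro hv
  set N := (G.neighborFinset v).filter fun u => (s u).vars.status ≠ 3 with hN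
  have hδ : N.card ≤ δ := h.degree_le v (by omega)
  have h1 : q * (β + 1) ≤ ∑ t ∈ Finset.range q, (N.filter fun u =>
      (f (s u).vars.color t = f (s v).vars.color t ∨
        (s u).vars.status = 1 ∧ (s u).vars.cls = f (s v).vars.color t)).card := by
    have : q * (β + 1) = ∑ t ∈ Finset.range q, (β + 1) := by simp
    rw [this]
    refine Finset.sum_le_sum fun t ht => ?_
    have := h.undecided v hv t (Finset.mem_range.1 ht)
    rw [hN, Finset.filter_filter]
    exact this
  have h2 : ∑ t ∈ Finset.range q, (N.filter fun u =>
      (f (s u).vars.color t = f (s v).vars.color t ∨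
        (s u).vars.status = 1 ∧ (s u).vars.cls = f (s v).vars.color t)).card ≤
      ∑ u ∈ N, 2 * D := by
    simp only [Finset.card_filter]
    rw [Finset.sum_comm]
    refine Finset.sum_le_sum fun u hu => ?_
    rw [← Finset.card_filter]
    have hu' : G.Adj v u := by
      rw [hN, Finset.mem_filter, SimpleGraph.mem_neighborFinset] at hu
      exact hu.1
    have ha := hf.agree _ (h.color_lt u) _ (h.color_lt v) (h.color_ne v u hu').symm
    have hb := hf.value _ (h.color_lt v) (s u).vars.cls
    calc _ ≤ (((Finset.range q).filter fun t => f (s u).vars.color t = f (s v).vars.color t) ∪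
          ((Finset.range q).filter fun t => f (s v).vars.color t = (s u).vars.cls)).card := by
          apply Finset.card_le_card
          intro t ht
          simp only [Finset.mem_union, Finset.mem_filter] at ht ⊢
          rcases ht.2 with h | h
          · exact Or.inl ⟨ht.1, h⟩
          · exact Or.inr ⟨ht.1, h.2.symm⟩
      _ ≤ _ := Finset.card_union_le _ _
      _ ≤ 2 * D := by omega
  rw [Finset.sum_const, smul_eq_mul] at h2
  have h3 : N.card * (2 * D) ≤ δ * (2 * D) := Nat.mul_le_mul_right _ hδ
  have h4 : δ * (2 * D) = 2 * D * δ := by ring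
  omega

theorem AssignInvariant.run (hf : IsCodeFamily m q D f) (hM : q + 4 ≤ M)
    {s : V → NodeState C} (h : AssignInvariant G L f M m δ β q 0 s) (t : ℕ) (ht : t ≤ q) :
    AssignInvariant G L f M m δ β q t
      (_root_.run M G L ((List.range t).map (assignRule f β)) s) := by
  induction t with
  | zero => exact h
  | succ t ih =>
    rw [List.range_succ, List.map_append, run_append]
    exact (ih (by omega)).succ hf hM (by omega)

end Assign

section Classes

variable {F : ℕ → Finset C → ℕ → Finset C} {β q l R τ m M c : ℕ}

/-- The state of affairs after the nodes of the classes smaller than `c` have been processed. -/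
structure ClassInvariant (G : SimpleGraph V) [DecidableRel G.Adj] (L : V → Finset C)
    (M m β q l c : ℕ) (s : V → NodeState C) : Prop extends Consistent G L M m s where
  status : ∀ v, (s v).vars.status = 1 ∨ (s v).vars.status = 3
  assigned : ∀ v, (s v).vars.status = 1 → (s v).vars.cls < q ∧
    ((G.neighborFinset v).filter fun u => (s u).vars.status = 1 ∧
      (s u).vars.cls = (s v).vars.cls ∧ (s u).vars.time ≤ (s v).vars.time).card ≤ β
  uncolored : ∀ v, (s v).vars.status = 1 → (s v).vars.cls < c → uncoloredDegree G s v + 1 < l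

/-- Effect of the three rounds of a class on the states of the nodes. -/
theorem run_classRules (hF : IsListFamily m β l R τ F) (hl : 1 ≤ l) (hM : l + R + 4 ≤ M)
    (hL : ∀ v, G.degree v + 1 ≤ (L v).card) {s : V → NodeState C}
    (h : ClassInvariant G L M m β q l c s) :
    ∃ s', run M G L (classRules F l R τ c) s = s' ∧
    (∀ v, (s' v = s v ∧ ((s v).vars.status = 1 → (s v).vars.cls = c →
        uncoloredDegree G s v + 1 < l)) ∨
      ((s v).vars.status = 1 ∧ (s' v).vars.status = 3 ∧ (s' v).vars.color = (s v).vars.color ∧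
        (s' v).vars.Bounded M ∧ (s' v).vars.index < (s' v).palette.card ∧ (s' v).palette ⊆ L v ∧
        (s' v).chosen ∈ available (L v) ((G.neighborFinset v).val.map s))) ∧
    ∀ u v, G.Adj u v → (s u).vars.status = 1 → (s v).vars.status = 1 →
      (s' u).vars.status = 3 → (s' v).vars.status = 3 → (s' u).chosen ≠ (s' v).chosen := by
  set av : V → Finset C := fun v => available (L v) ((G.neighborFinset v).val.map s) with hav
  set P : V → Prop := fun v => (s v).vars.status = 1 ∧ (s v).vars.cls = c ∧ l ≤ (av v).card with hP
  have havL : ∀ v, av v ⊆ L v := fun v => Finset.filter_subset _ _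
  -- publishing
  obtain ⟨S, hS⟩ : ∃ S : V → Finset C, ∀ v, P v → S v ⊆ av v ∧ (S v).card = l ∧
      publishRule l c (L v) (s v) ((G.neighborFinset v).val.map s) = ⟨(s v).vars, S v⟩ := by
    refine ⟨fun v => if h : P v then (Finset.exists_subset_card_eq h.2.2).choose else ∅,
      fun v hv => ?_⟩
    simp only [hv, dif_pos]
    refine ⟨(Finset.exists_subset_card_eq hv.2.2).choose_spec.1,
      (Finset.exists_subset_card_eq hv.2.2).choose_spec.2, ?_⟩
    simp only [publishRule]
    rw [dif_pos hv]
  set s₁ := runRound M G L s (publishRule l c) with hs₁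
  have hs₁P : ∀ v, P v → s₁ v = ⟨(s v).vars, S v⟩ := by
    intro v hv
    obtain ⟨h1, h2, h3⟩ := hS v hv
    rw [hs₁, runRound_eq, h3]
    rw [h3]
    refine Or.inr (Or.inr ⟨rfl, h.palette_empty v (by have := hv.1; omega), ?_,
      h1.trans (havL v)⟩)
    exact Finset.card_pos.1 (by simp only; omega)
  have hs₁N : ∀ v, ¬ P v → s₁ v = s v := by
    intro v hv
    have : publishRule l c (L v) (s v) ((G.neighborFinset v).val.map s) = s v := by
      simp only [publishRule]
      rw [dif_neg hv]
    rw [hs₁, runRound_eq (Or.inl this), this]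
  have hSne : ∀ v, P v → (S v).Nonempty := fun v hv =>
    Finset.card_pos.1 (by rw [(hS v hv).2.1]; omega)
  have hP₁ : ∀ v, ((s₁ v).vars.status = 1 ∧ (s₁ v).vars.cls = c ∧ (s₁ v).palette.Nonempty) ↔ P v := by
    intro v
    by_cases hv : P v
    · rw [hs₁P v hv]
      exact ⟨fun _ => hv, fun _ => ⟨hv.1, hv.2.1, hSne v hv⟩⟩
    · rw [hs₁N v hv]
      refine ⟨fun h' => ?_, fun h' => absurd h' hv⟩
      rw [h.palette_empty v (by omega)] at h'
      exact absurd h'.2.2 (by simp)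
  -- picking
  obtain ⟨ρ, hρ⟩ : ∃ ρ : V → ℕ, ∀ v, P v → ρ v < R ∧
      (∀ u, G.Adj v u → P u → (s u).vars.time ≤ (s v).vars.time → ∀ r' < R,
        (F (s v).vars.color (S v) (ρ v) ∩ F (s u).vars.color (S u) r').card ≤ τ) ∧
      pickRule F R τ c (L v) (s₁ v) ((G.neighborFinset v).val.map s₁) =
        ⟨{ (s v).vars with status := 2, index := ρ v }, S v⟩ := by
    have key : ∀ v, ∃ r, P v → r < R ∧
      (∀ u, G.Adj v u → P u → (s u).vars.time ≤ (s v).vars.time → ∀ r' < R,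
        (F (s v).vars.color (S v) r ∩ F (s u).vars.color (S u) r').card ≤ τ) ∧
      pickRule F R τ c (L v) (s₁ v) ((G.neighborFinset v).val.map s₁) =
        ⟨{ (s v).vars with status := 2, index := r }, S v⟩ := by
      intro v
      by_cases hv : P v
      swap
      · exact ⟨0, fun h' => absurd h' hv⟩
      have hcond : ((s₁ v).vars.status = 1 ∧ (s₁ v).vars.cls = c ∧ (s₁ v).palette.Nonempty) ∧
          ∃ r < R, ∀ y ∈ (G.neighborFinset v).val.map s₁,
          y.vars.status = 1 → y.vars.cls = c → y.palette.Nonempty →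
          y.vars.time ≤ (s₁ v).vars.time → ∀ r' < R, (F (s₁ v).vars.color (s₁ v).palette r ∩
            F y.vars.color y.palette r').card ≤ τ := by
        refine ⟨(hP₁ v).2 hv, ?_⟩
        -- The opponents are the publishing neighbors that joined no later: at most `β` by the class
        -- assignment, with colors different from that of `v` by properness.
        obtain ⟨r, hr, hY⟩ := hF.sparse _ (h.color_lt v) (S v) (hS v hv).2.1
          (((G.neighborFinset v).filter fun u => P u ∧ (s u).vars.time ≤ (s v).vars.time).image
            fun u => ((s u).vars.color, S u)) (by
            refine Finset.card_image_le.trans (le_trans (Finset.card_le_card ?_)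
              (h.assigned v hv.1).2)
            intro u hu
            simp only [Finset.mem_filter] at hu ⊢
            exact ⟨hu.1, hu.2.1.1, by rw [hu.2.1.2.1, hv.2.1], hu.2.2⟩) (by
            intro y hy
            simp only [Finset.mem_image, Finset.mem_filter, SimpleGraph.mem_neighborFinset] at hy
            obtain ⟨u, ⟨hvu, hu, -⟩, rfl⟩ := hy
            exact ⟨h.color_lt u, (hS u hu).2.1, (h.color_ne v u hvu).symm⟩)
        refine ⟨r, hr, fun y hy h1 h2 h3 h4 r' hr' => ?_⟩
        obtain ⟨u, hu, rfl⟩ := Multiset.mem_map.1 hy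
        have hPu := (hP₁ u).1 ⟨h1, h2, h3⟩
        rw [hs₁P u hPu, hs₁P v hv] at h4 ⊢
        exact hY ((s u).vars.color, S u) (Finset.mem_image.2 ⟨u, Finset.mem_filter.2
          ⟨hu, hPu, h4⟩, rfl⟩) r' hr'
      refine ⟨hcond.2.choose, fun _ => ?_⟩
      have hspec := hcond.2.choose_spec
      have hrule : pickRule F R τ c (L v) (s₁ v) ((G.neighborFinset v).val.map s₁) =
          ⟨{ (s₁ v).vars with status := 2, index := hcond.2.choose }, (s₁ v).palette⟩ := by
        simp only [pickRule]
        rw [dif_pos hcond]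
      rw [hrule]
      generalize hcond.2.choose = r at hspec ⊢
      rw [hs₁P v hv] at hspec ⊢
      refine ⟨hspec.1, fun u hvu hu htime r' hr' => ?_, rfl⟩
      have := hspec.2 (s₁ u) (Multiset.mem_map.2 ⟨u, by simpa using hvu, rfl⟩)
        ((hP₁ u).2 hu).1 ((hP₁ u).2 hu).2.1 ((hP₁ u).2 hu).2.2
        (by rw [hs₁P u hu]; exact htime) r' hr'
      rwa [hs₁P u hu] at this
    choose ρ hρ using key
    exact ⟨ρ, hρ⟩
  set s₂ := runRound M G L s₁ (pickRule F R τ c) with hs₂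
  have hs₂P : ∀ v, P v → s₂ v = ⟨{ (s v).vars with status := 2, index := ρ v }, S v⟩ := by
    intro v hv
    obtain ⟨h1, h2, h3⟩ := hρ v hv
    rw [hs₂, runRound_eq, h3]
    rw [h3, hs₁P v hv]
    have := h.bounded v
    exact Or.inr (Or.inl ⟨rfl, this.1, by simp; omega, this.2.2.1, this.2.2.2.1, by simp; omega⟩)
  have hs₂N : ∀ v, ¬ P v → s₂ v = s v := by
    intro v hv
    have : pickRule F R τ c (L v) (s₁ v) ((G.neighborFinset v).val.map s₁) = s₁ v := by
      simp only [pickRule]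
      rw [dif_neg]
      exact fun h' => hv ((hP₁ v).1 h'.1)
    rw [hs₂, runRound_eq (Or.inl this), this, hs₁N v hv]
  have hP₂ : ∀ v, (s₂ v).vars.status = 2 ↔ P v := by
    intro v
    by_cases hv : P v
    · rw [hs₂P v hv]
      simp [hv]
    · rw [hs₂N v hv]
      have := h.status v
      exact ⟨fun h' => by omega, fun h' => absurd h' hv⟩
  -- choosing
  obtain ⟨ν, hν⟩ : ∃ ν : V → ℕ, ∀ v, P v → ν v < (S v).card ∧
      nthColor (S v) (ν v) ∈ F (s v).vars.color (S v) (ρ v) ∧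
      (∀ u, G.Adj v u → P u → (s u).vars.time ≤ (s v).vars.time →
        nthColor (S v) (ν v) ∉ F (s u).vars.color (S u) (ρ u)) ∧
      finishRule F (L v) (s₂ v) ((G.neighborFinset v).val.map s₂) =
        ⟨{ (s v).vars with status := 3, index := ν v }, S v⟩ := by
    have key : ∀ v, ∃ j, P v → j < (S v).card ∧
      nthColor (S v) j ∈ F (s v).vars.color (S v) (ρ v) ∧
      (∀ u, G.Adj v u → P u → (s u).vars.time ≤ (s v).vars.time →
        nthColor (S v) j ∉ F (s u).vars.color (S u) (ρ u)) ∧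
      finishRule F (L v) (s₂ v) ((G.neighborFinset v).val.map s₂) =
        ⟨{ (s v).vars with status := 3, index := j }, S v⟩ := by
      intro v
      by_cases hv : P v
      swap
      · exact ⟨0, fun h' => absurd h' hv⟩
      obtain ⟨h1, h2, -⟩ := hρ v hv
      have e : s₂ v = _ := hs₂P v hv
      have hcond : (s₂ v).vars.status = 2 ∧ ∃ j < (s₂ v).palette.card,
          nthColor (s₂ v).palette j ∈ F (s₂ v).vars.color (s₂ v).palette (s₂ v).vars.index ∧
          ∀ y ∈ (G.neighborFinset v).val.map s₂, y.vars.status = 2 →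
          y.vars.time ≤ (s₂ v).vars.time →
          nthColor (s₂ v).palette j ∉ F y.vars.color y.palette y.vars.index := by
        refine ⟨(hP₂ v).2 hv, ?_⟩
        set N := (G.neighborFinset v).filter fun u => P u ∧ (s u).vars.time ≤ (s v).vars.time
          with hN
        have hNc : N.card ≤ β := by
          refine le_trans (Finset.card_le_card ?_) (h.assigned v hv.1).2
          intro u hu
          simp only [hN, Finset.mem_filter] at hu ⊢
          exact ⟨hu.1, hu.2.1.1, by rw [hu.2.1.2.1, hv.2.1], hu.2.2⟩
        -- The spoiled colors number at most `β * τ`, fewer than the pick contains.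
        set B := N.biUnion fun u => F (s v).vars.color (S v) (ρ v) ∩
          F (s u).vars.color (S u) (ρ u) with hB
        have hBc : B.card < (F (s v).vars.color (S v) (ρ v)).card := by
          refine lt_of_le_of_lt ?_ (hF.card _ (h.color_lt v) (S v) (hS v hv).2.1 _ h1)
          calc B.card ≤ ∑ u ∈ N, _ := Finset.card_biUnion_le
            _ ≤ ∑ u ∈ N, τ := by
                refine Finset.sum_le_sum fun u hu => ?_
                simp only [hN, Finset.mem_filter, SimpleGraph.mem_neighborFinset] at hu
                exact h2 u hu.1 hu.2.1 hu.2.2 _ (hρ u hu.2.1).1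
            _ = N.card * τ := by rw [Finset.sum_const, smul_eq_mul]
            _ ≤ β * τ := Nat.mul_le_mul_right _ hNc
        obtain ⟨a, ha, haB⟩ := Finset.exists_mem_notMem_of_card_lt_card hBc
        obtain ⟨j, hj, rfl⟩ := exists_nthColor_eq
          (hF.subset _ (h.color_lt v) (S v) (hS v hv).2.1 _ h1 ha)
        rw [e]
        refine ⟨j, hj, ha, fun y hy hy2 hyt hyF => haB ?_⟩
        obtain ⟨u, hu, rfl⟩ := Multiset.mem_map.1 hy
        have hPu := (hP₂ u).1 hy2
        rw [hs₂P u hPu] at hyt hyF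
        rw [hB, Finset.mem_biUnion]
        exact ⟨u, by rw [hN, Finset.mem_filter]; exact ⟨hu, hPu, hyt⟩,
          Finset.mem_inter.2 ⟨ha, hyF⟩⟩
      refine ⟨hcond.2.choose, fun _ => ?_⟩
      have hspec := hcond.2.choose_spec
      have hrule : finishRule F (L v) (s₂ v) ((G.neighborFinset v).val.map s₂) =
          ⟨{ (s₂ v).vars with status := 3, index := hcond.2.choose }, (s₂ v).palette⟩ := by
        simp only [finishRule]
        rw [dif_pos hcond]
      rw [hrule]
      generalize hcond.2.choose = j at hspec ⊢
      rw [e] at hspec ⊢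
      obtain ⟨g1, g2, g3⟩ := hspec
      refine ⟨g1, g2, fun u hvu hu htime => ?_, rfl⟩
      have := g3 (s₂ u) (Multiset.mem_map.2 ⟨u, by simpa using hvu, rfl⟩) ((hP₂ u).2 hu)
        (by rw [hs₂P u hu]; exact htime)
      rwa [hs₂P u hu] at this
    choose ν hν using key
    exact ⟨ν, hν⟩
  set s₃ := runRound M G L s₂ (finishRule F) with hs₃
  have hbd : ∀ v, P v →
      NodeVars.Bounded { (s v).vars with status := 3, index := ν v } M := by
    intro v hv
    have h1 := (hν v hv).1
    rw [(hS v hv).2.1] at h1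
    have := h.bounded v
    exact ⟨this.1, by simp; omega, this.2.2.1, this.2.2.2.1, by simp; omega⟩
  have hs₃P : ∀ v, P v → s₃ v = ⟨{ (s v).vars with status := 3, index := ν v }, S v⟩ := by
    intro v hv
    obtain ⟨h1, h2, h3, h4⟩ := hν v hv
    rw [hs₃, runRound_eq, h4]
    rw [h4, hs₂P v hv]
    exact Or.inr (Or.inl ⟨rfl, hbd v hv⟩)
  have hs₃N : ∀ v, ¬ P v → s₃ v = s v := by
    intro v hv
    have : finishRule F (L v) (s₂ v) ((G.neighborFinset v).val.map s₂) = s₂ v := by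
      simp only [finishRule]
      rw [dif_neg]
      exact fun h' => hv ((hP₂ v).1 h'.1)
    rw [hs₃, runRound_eq (Or.inl this), this, hs₂N v hv]
  refine ⟨s₃, rfl, fun v => ?_, ?_⟩
  · by_cases hv : P v
    · right
      rw [hs₃P v hv]
      exact ⟨hv.1, rfl, rfl, hbd v hv, (hν v hv).1, (hS v hv).1.trans (havL v),
        (hS v hv).1 (nthColor_mem (hν v hv).1)⟩
    · refine Or.inl ⟨hs₃N v hv, fun h1 h2 => ?_⟩
      have h3 := uncoloredDegree_add_one_le (s := s) (hL v)
      have h4 : (av v).card < l := lt_of_not_ge fun h' => hv ⟨h1, h2, h'⟩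
      exact lt_of_le_of_lt h3 h4
  · intro u v huv hu hv hu3 hv3
    have hPu : P u := by
      by_contra hc
      rw [hs₃N u hc] at hu3
      omega
    have hPv : P v := by
      by_contra hc
      rw [hs₃N v hc] at hv3
      omega
    rw [hs₃P u hPu, hs₃P v hPv]
    intro heq
    have heq : nthColor (S u) (ν u) = nthColor (S v) (ν v) := heq
    -- The node with the larger time has avoided the other's entire pick, hence also its final
    -- color.
    rcases le_total (s u).vars.time (s v).vars.time with ht | ht
    · have := (hν v hPv).2.2.1 u huv.symm hPu ht
      rw [← heq] at this
      exact this (hν u hPu).2.1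
    · have := (hν u hPu).2.2.1 v huv hPv ht
      rw [heq] at this
      exact this (hν v hPv).2.1

/-- Only nodes of class `c` change, and those left over had too few available colors. Since
uncolored degrees never grow, the bounds obtained for earlier classes survive. -/
theorem ClassInvariant.succ (hF : IsListFamily m β l R τ F) (hl : 1 ≤ l) (hM : l + R + 4 ≤ M)
    (hL : ∀ v, G.degree v + 1 ≤ (L v).card) {s : V → NodeState C}
    (h : ClassInvariant G L M m β q l c s) :
    ClassInvariant G L M m β q l (c + 1) (run M G L (classRules F l R τ c) s) := by
  obtain ⟨s', hs', hcase, hne⟩ := run_classRules hF hl hM hL h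
  rw [hs']
  have h1 : ∀ v, (s' v).vars.status = 1 → s' v = s v ∧ ((s v).vars.cls = c →
      uncoloredDegree G s v + 1 < l) := by
    intro v hv
    rcases hcase v with h' | h'
    · exact ⟨h'.1, h'.2 (by rw [← h'.1]; exact hv)⟩
    · omega
  have h3 : ∀ v, (s v).vars.status = 3 → s' v = s v := by
    intro v hv
    rcases hcase v with h' | h'
    · exact h'.1
    · omega
  have hcol : ∀ v, (s' v).vars.color = (s v).vars.color := by
    intro v
    rcases hcase v with h' | h'
    · rw [h'.1]
    · exact h'.2.2.1
  have hst : ∀ v, (s' v).vars.status = 1 ∨ (s' v).vars.status = 3 := by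
    intro v
    rcases hcase v with h' | h'
    · rw [h'.1]; exact h.status v
    · exact Or.inr h'.2.1
  have hunc : ∀ v, uncoloredDegree G s' v ≤ uncoloredDegree G s v := by
    intro v
    refine Finset.card_le_card (Finset.monotone_filter_right _ ?_)
    intro u _ hu hc
    exact hu (by rw [h3 u hc]; exact hc)
  have hmix : ∀ u v, G.Adj u v → (s u).vars.status = 3 → (s v).vars.status = 1 →
      (s' v).vars.status = 3 → (s u).chosen ≠ (s' v).chosen := by
    intro u v huv hu hv hv3
    rcases hcase v with h' | h'
    · rw [h'.1] at hv3; omega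
    · have := h'.2.2.2.2.2.2
      simp only [available, Finset.mem_filter] at this
      exact this.2 (s u) (Multiset.mem_map.2 ⟨u, by simpa using huv.symm, rfl⟩) hu
  refine ⟨⟨?_, fun v => by rw [hcol]; exact h.color_lt v,
    fun u v huv => by rw [hcol, hcol]; exact h.color_ne u v huv, ?_, ?_, ?_, ?_⟩, hst, ?_, ?_⟩
  · intro v
    rcases hcase v with h' | h'
    · rw [h'.1]; exact h.bounded v
    · exact h'.2.2.2.1
  · intro v hv
    rcases hcase v with h' | h'
    · rw [h'.1] at hv ⊢; exact h.index_lt v hv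
    · exact h'.2.2.2.2.1
  · intro v hv
    rcases hcase v with h' | h'
    · rw [h'.1] at hv ⊢; exact h.palette_subset v hv
    · exact h'.2.2.2.2.2.1
  · intro u v huv hu hv
    rcases h.status u with hu1 | hu1 <;> rcases h.status v with hv1 | hv1
    · exact hne u v huv hu1 hv1 hu hv
    · rw [h3 v hv1]
      exact (hmix v u huv.symm hv1 hu1 hu).symm
    · rw [h3 u hu1]
      exact hmix u v huv hu1 hv1 hv
    · rw [h3 u hu1, h3 v hv1]
      exact h.chosen_ne u v huv hu1 hv1
  · intro v hv
    have hv1 : (s' v).vars.status = 1 := by have := hst v; omega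
    rw [(h1 v hv1).1] at hv ⊢
    exact h.palette_empty v hv
  · intro v hv
    have e := (h1 v hv).1
    rw [e] at hv ⊢
    obtain ⟨g1, g2⟩ := h.assigned v hv
    refine ⟨g1, le_trans (Finset.card_le_card ?_) g2⟩
    refine Finset.monotone_filter_right _ ?_
    intro u _ hu
    rwa [(h1 u hu.1).1] at hu
  · intro v hv hc
    obtain ⟨e, h2⟩ := h1 v hv
    rw [e] at hv hc
    have := hunc v
    rcases Nat.lt_succ_iff_lt_or_eq.1 hc with h' | h'
    · have := h.uncolored v hv h'; omega
    · have := h2 h'; omega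

theorem ClassInvariant.run (hF : IsListFamily m β l R τ F) (hl : 1 ≤ l) (hM : l + R + 4 ≤ M)
    (hL : ∀ v, G.degree v + 1 ≤ (L v).card) {s : V → NodeState C}
    (h : ClassInvariant G L M m β q l 0 s) (c : ℕ) :
    ClassInvariant G L M m β q l c
      (_root_.run M G L ((List.range c).flatMap (classRules F l R τ)) s) := by
  induction c with
  | zero => exact h
  | succ c ih =>
    rw [List.range_succ, List.flatMap_append, run_append]
    simpa using ih.succ hF hl hM hL

end Classes

/-- A partial list coloring whose uncolored nodes have at most `δ` uncolored neighbors and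
are all undecided. -/
structure StageInvariant (G : SimpleGraph V) [DecidableRel G.Adj] (L : V → Finset C)
    (M m δ : ℕ) (s : V → NodeState C) : Prop extends Consistent G L M m s where
  status : ∀ v, (s v).vars.status = 0 ∨ (s v).vars.status = 3
  degree_le : ∀ v, (s v).vars.status = 0 → uncoloredDegree G s v ≤ δ

/-- After a stage, the uncolored nodes have few uncolored neighbors. -/
theorem run_stageRules {f : ℕ → ℕ → ℕ} {F : ℕ → Finset C → ℕ → Finset C}
    {β q l R τ m M D δ : ℕ} (hf : IsCodeFamily m q D f) (hq : 2 * D * δ < q * (β + 1))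
    (hF : IsListFamily m β l R τ F) (hl : 1 ≤ l) (hM₁ : q + 4 ≤ M) (hM₂ : l + R + 4 ≤ M)
    (hL : ∀ v, G.degree v + 1 ≤ (L v).card) {s : V → NodeState C}
    (h : StageInvariant G L M m δ s) :
    StageInvariant G L M m (l - 2) (run M G L (stageRules f F β q l R τ) s) ∧
    ∀ v, (run M G L (stageRules f F β q l R τ) s v).vars.status = 0 → 2 ≤ l := by
  have hA : AssignInvariant G L f M m δ β q 0 s := by
    refine ⟨h.toConsistent, fun v => (h.status v).imp_right Or.inr, fun v hv => ?_, fun v hv => ?_,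
      fun v _ t' ht' => absurd ht' (by omega)⟩
    · exact h.degree_le v (by have := h.status v; omega)
    · have := h.status v; omega
  have hA' := hA.run hf hM₁ q le_rfl
  unfold stageRules
  rw [run_append, run_append]
  set s₁ := run M G L ((List.range q).map (assignRule f β)) s with hs₁
  have hst₁ : ∀ v, (s₁ v).vars.status = 1 ∨ (s₁ v).vars.status = 3 := by
    intro v
    have h1 := hA'.decided hf hq v
    have h2 := hA'.status v
    omega
  have hC : ClassInvariant G L M m β q l 0 s₁ :=
    ⟨hA'.toConsistent, hst₁, fun v hv => ⟨(hA'.assigned v hv).1, (hA'.assigned v hv).2.2⟩,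
      fun v _ hc => absurd hc (by omega)⟩
  have hC' := hC.run hF hl hM₂ hL q
  set s₂ := run M G L ((List.range q).flatMap (classRules F l R τ)) s₁ with hs₂
  have hrun : run M G L [resetRule] s₂ = runRound M G L s₂ resetRule := rfl
  rw [hrun]
  set s₃ := runRound M G L s₂ resetRule with hs₃
  have hs : ∀ v, s₃ v = if (s₂ v).vars.status = 1 then
      ⟨{ (s₂ v).vars with status := 0 }, (s₂ v).palette⟩ else s₂ v := by
    intro v
    rw [hs₃, runRound_eq]
    · rfl
    · have := hC'.bounded v
      simp only [resetRule]
      split_ifs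
      · exact Or.inr (Or.inl ⟨rfl, this.1, by simp; omega, this.2.2⟩)
      · exact Or.inl rfl
  have hpos : ∀ v, (s₂ v).vars.status = 1 →
      s₃ v = ⟨{ (s₂ v).vars with status := 0 }, (s₂ v).palette⟩ := fun v hv => by
    rw [hs, if_pos hv]
  have hneg : ∀ v, (s₂ v).vars.status ≠ 1 → s₃ v = s₂ v := fun v hv => by rw [hs, if_neg hv]
  have hst : ∀ v, ((s₂ v).vars.status = 1 ∧ (s₃ v).vars.status = 0) ∨
      ((s₃ v).vars.status = 3 ∧ s₃ v = s₂ v) := by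
    intro v
    rcases hC'.status v with h' | h'
    · exact Or.inl ⟨h', by rw [hpos v h']⟩
    · have e := hneg v (by omega)
      exact Or.inr ⟨by rw [e]; exact h', e⟩
  have hcol : ∀ v, (s₃ v).vars.color = (s₂ v).vars.color := fun v => by rw [hs]; split_ifs <;> rfl
  have hpal : ∀ v, (s₃ v).palette = (s₂ v).palette := fun v => by rw [hs]; split_ifs <;> rfl
  have h3 : ∀ v, (s₃ v).vars.status = 3 → s₃ v = s₂ v := by
    intro v hv
    rcases hst v with h' | h'
    · omega
    · exact h'.2
  have hunc : ∀ v, uncoloredDegree G s₃ v = uncoloredDegree G s₂ v := by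
    intro v
    unfold uncoloredDegree
    congr 1
    refine Finset.filter_congr fun u _ => not_congr ?_
    rcases hst u with h' | h'
    · omega
    · rw [h'.2]
  -- This form, unlike the truncated `l - 2`, shows that for `l = 1` no uncolored node remains; the
  -- last stage relies on it.
  have hdeg : ∀ v, (s₃ v).vars.status = 0 → uncoloredDegree G s₃ v + 1 < l := by
    intro v hv
    have h1 : (s₂ v).vars.status = 1 := by
      rcases hst v with h' | h'
      · exact h'.1
      · omega
    rw [hunc]
    exact hC'.uncolored v h1 (hC'.assigned v h1).1
  refine ⟨⟨⟨?_, fun v => by rw [hcol]; exact hC'.color_lt v,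
    fun u v huv => by rw [hcol, hcol]; exact hC'.color_ne u v huv, ?_, ?_, ?_, ?_⟩, ?_, ?_⟩, ?_⟩
  · intro v
    have := hC'.bounded v
    rw [hs]
    split_ifs
    · exact ⟨this.1, by simp; omega, this.2.2⟩
    · exact this
  · intro v hv
    have ev := h3 v hv
    rw [ev] at hv ⊢
    exact hC'.index_lt v hv
  · intro v hv
    have ev := h3 v hv
    rw [ev] at hv ⊢
    exact hC'.palette_subset v hv
  · intro u v huv hu hv
    have ev := h3 v hv
    have eu := h3 u hu
    rw [ev] at hv ⊢
    rw [eu] at hu ⊢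
    exact hC'.chosen_ne u v huv hu hv
  · intro v hv
    rw [hpal]
    rcases hst v with h' | h'
    · exact hC'.palette_empty v (by omega)
    · omega
  · intro v
    rcases hst v with h' | h' <;> omega
  · intro v hv
    have := hdeg v hv
    omega
  · intro v hv
    have := hdeg v hv
    omega

end Coloring

/-! ### One-round color reductions: Linial's and bit tests. -/

/-- A one-round color reduction from `m` to `m'` colors in graphs of maximum degree `d`: the new
color of a node is computed from its color and the colors of its neighbors. -/
structure IsReduction (d m m' : ℕ) (g : ℕ → Finset ℕ → ℕ) : Prop where
  lt : ∀ x < m, ∀ X ⊆ Finset.range m, x ∉ X → X.card ≤ d → g x X < m'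
  ne : ∀ x < m, ∀ y < m, ∀ X ⊆ Finset.range m, ∀ Y ⊆ Finset.range m, x ∉ X → y ∉ Y →
    X.card ≤ d → Y.card ≤ d → y ∈ X → x ∈ Y → g x X ≠ g y Y

open Classical in
/-- Linial's color reduction. -/
theorem IsCodeFamily.exists_isReduction {m q D d : ℕ} {f : ℕ → ℕ → ℕ} (hf : IsCodeFamily m q D f)
    (hq : D * d < q) : ∃ g, IsReduction d m (q * q) g := by
  have key : ∀ x < m, ∀ X ⊆ Finset.range m, x ∉ X → X.card ≤ d →
      ∃ t < q, ∀ y ∈ X, f x t ≠ f y t := by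
    intro x hx X hX hxX hd
    have hlt : (X.biUnion fun y => (Finset.range q).filter fun t => f x t = f y t).card <
        (Finset.range q).card := by
      rw [Finset.card_range]
      calc _ ≤ ∑ y ∈ X, ((Finset.range q).filter fun t => f x t = f y t).card :=
            Finset.card_biUnion_le
        _ ≤ ∑ y ∈ X, D := Finset.sum_le_sum fun y hy =>
            hf.agree x hx y (Finset.mem_range.1 (hX hy)) (fun h => hxX (h ▸ hy))
        _ = X.card * D := by rw [Finset.sum_const, smul_eq_mul]
        _ ≤ d * D := Nat.mul_le_mul_right _ hd
        _ < q := by rwa [mul_comm]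
    obtain ⟨t, ht, hn⟩ := Finset.exists_mem_notMem_of_card_lt_card hlt
    refine ⟨t, Finset.mem_range.1 ht, fun y hy heq => hn ?_⟩
    exact Finset.mem_biUnion.2 ⟨y, hy, Finset.mem_filter.2 ⟨ht, heq⟩⟩
  choose! τ hτ using key
  -- The new color encodes a point at which `f x` differs from all neighbors, together with the
  -- value there. Equal codes on adjacent nodes would give a common point and a common value.
  refine ⟨fun x X => q * τ x X + f x (τ x X), ⟨?_, ?_⟩⟩
  · intro x hx X hX hxX hd
    have h1 := (hτ x hx X hX hxX hd).1
    have h2 := hf.lt x hx _ h1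
    calc q * τ x X + f x (τ x X) < q * τ x X + q := by omega
      _ = q * (τ x X + 1) := by ring
      _ ≤ q * q := Nat.mul_le_mul_left _ h1
  · intro x hx y hy X hX Y hY hxX hyY hdX hdY hyX hxY heq
    obtain ⟨h1, h1'⟩ := hτ x hx X hX hxX hdX
    obtain ⟨h2, h2'⟩ := hτ y hy Y hY hyY hdY
    have l1 := hf.lt x hx _ h1
    have l2 := hf.lt y hy _ h2
    have hq0 : 0 < q := by omega
    have ht : τ x X = τ y Y := by
      have := congrArg (· / q) heq
      simpa [Nat.mul_add_div hq0, Nat.div_eq_of_lt l1, Nat.div_eq_of_lt l2] using this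
    have hv : f x (τ x X) = f y (τ y Y) := by
      simp only [ht] at heq ⊢
      omega
    exact h1' y hyX (by rw [hv, ht])

/-- The set of pairs of a choice of bit positions and a Boolean function of the chosen bits. -/
abbrev BitTest (d l : ℕ) := (Fin d × Fin d → Fin l) × ((Fin d × Fin d → Bool) → Bool)

/-- Evaluation of a Boolean function at some bits of a number. -/
def BitTest.eval {d l : ℕ} (h : BitTest d l) (i : ℕ) : Bool := h.2 fun ab => i.testBit (h.1 ab)

theorem exists_testBit_ne {x y k : ℕ} (hx : x < 2 ^ k) (hy : y < 2 ^ k) (hxy : x ≠ y) :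
    ∃ i < k, x.testBit i ≠ y.testBit i := by
  by_contra hc
  push Not at hc
  apply hxy
  apply Nat.eq_of_testBit_eq
  intro i
  rcases Nat.lt_or_ge i k with h | h
  · exact hc i h
  · rw [Nat.testBit_lt_two_pow (hx.trans_le (Nat.pow_le_pow_right (by norm_num) h)),
      Nat.testBit_lt_two_pow (hy.trans_le (Nat.pow_le_pow_right (by norm_num) h))]

/-- Every Boolean function on at most `d` numbers of `l` bits extends to a bit test. -/
theorem exists_bitTest {d l : ℕ} (hl : 0 < l) (I : Finset ℕ) (hI : ∀ i ∈ I, i < 2 ^ l)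
    (hd : I.card ≤ d) (b : ℕ → Bool) : ∃ h : BitTest d l, ∀ i ∈ I, h.eval i = b i := by
  classical
  obtain ⟨φ⟩ : Nonempty (I ↪ Fin d) := Function.Embedding.nonempty_of_card_le (by simpa using hd)
  -- One bit position per pair of labels separates that pair; hence the `d * d` chosen bits
  -- distinguish all elements of `I`.
  have hJ : ∃ J : Fin d × Fin d → Fin l, ∀ i j : I, i ≠ j →
      (i : ℕ).testBit (J (φ i, φ j)) ≠ (j : ℕ).testBit (J (φ i, φ j)) := by
    have : ∀ ab : Fin d × Fin d, ∃ p : Fin l, ∀ i j : I, i ≠ j → (φ i, φ j) = ab →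
        (i : ℕ).testBit p ≠ (j : ℕ).testBit p := by
      intro ab
      by_cases h : ∃ i j : I, i ≠ j ∧ (φ i, φ j) = ab
      · obtain ⟨i, j, hij, rfl⟩ := h
        obtain ⟨p, hp, hne⟩ := exists_testBit_ne (hI i i.2) (hI j j.2)
          (fun h => hij (Subtype.ext h))
        refine ⟨⟨p, hp⟩, fun i' j' _ heq => ?_⟩
        rw [Prod.mk.injEq, φ.injective.eq_iff, φ.injective.eq_iff] at heq
        rw [heq.1, heq.2]
        exact hne
      · exact ⟨⟨0, hl⟩, fun i j hij heq => absurd ⟨i, j, hij, heq⟩ h⟩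
    choose J hJ using this
    exact ⟨J, fun i j hij => hJ _ i j hij rfl⟩
  obtain ⟨J, hJ⟩ := hJ
  let sig : I → (Fin d × Fin d → Bool) := fun i ab => (i : ℕ).testBit (J ab)
  have hsig : Function.Injective sig := by
    intro i j h
    by_contra hij
    exact hJ i j hij (congrFun h (φ i, φ j))
  refine ⟨(J, fun z => if hz : ∃ i : I, sig i = z then b hz.choose else false), fun i hi => ?_⟩
  have hz : ∃ i' : I, sig i' = fun ab => i.testBit (J ab) := ⟨⟨i, hi⟩, rfl⟩
  have hz' : hz.choose = ⟨i, hi⟩ := hsig hz.choose_spec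
  simp only [BitTest.eval]
  rw [dif_pos hz, hz']

/-- A color reduction from `2 ^ 2 ^ l` to polynomially many colors in `l`, for fixed degree. -/
theorem exists_isReduction_bitTest {d m k l : ℕ} (hm : m ≤ 2 ^ k) (hk : k ≤ 2 ^ l) (hl : 0 < l) :
    ∃ g, IsReduction d m (l ^ (d * d) * 2 ^ 2 ^ (d * d)) g := by
  classical
  have hdiff : ∃ δ : ℕ → ℕ → ℕ, ∀ x < m, ∀ y < m, x ≠ y → δ x y = δ y x ∧ δ x y < 2 ^ l ∧
      x.testBit (δ x y) ≠ y.testBit (δ x y) := by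
    have : ∀ z : ℕ, ∃ i, z ≠ 0 → z.testBit i = true := by
      intro z
      by_cases hz : z = 0
      · exact ⟨0, fun h => absurd hz h⟩
      · obtain ⟨i, hi⟩ := Nat.exists_testBit_of_ne_zero hz
        exact ⟨i, fun _ => hi⟩
    choose ψ hψ using this
    -- Taking a position that depends only on the symmetric `x ^^^ y` makes both endpoints of an
    -- edge refer to the same bit.
    refine ⟨fun x y => ψ (x ^^^ y), fun x hx y hy hxy => ⟨by simp only [Nat.xor_comm], ?_, ?_⟩⟩
    · have h1 := hψ (x ^^^ y) (fun h => hxy (Nat.xor_eq_zero_iff.1 h))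
      by_contra hc
      rw [Nat.testBit_lt_two_pow] at h1
      · exact absurd h1 (by simp)
      · refine lt_of_lt_of_le (Nat.xor_lt_two_pow (hx.trans_le hm) (hy.trans_le hm)) ?_
        exact Nat.pow_le_pow_right (by norm_num) (hk.trans (not_lt.1 hc))
    · have h1 := hψ (x ^^^ y) (fun h => hxy (Nat.xor_eq_zero_iff.1 h))
      rw [Nat.testBit_xor] at h1
      intro h2
      rw [h2] at h1
      simp at h1
  obtain ⟨δ, hδ⟩ := hdiff
  -- The new color is a test that reproduces the bits of `x` at the positions `δ x y`. Two adjacent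
  -- nodes with the same test would agree at a bit where they differ.
  have key : ∀ x < m, ∀ X ⊆ Finset.range m, x ∉ X → X.card ≤ d →
      ∃ h : BitTest d l, ∀ y ∈ X, h.eval (δ x y) = x.testBit (δ x y) := by
    intro x hx X hX hxX hd
    obtain ⟨h, hh⟩ := exists_bitTest (d := d) hl (X.image (δ x)) (by
      intro i hi
      obtain ⟨y, hy, rfl⟩ := Finset.mem_image.1 hi
      exact (hδ x hx y (Finset.mem_range.1 (hX hy)) (fun h => hxX (h ▸ hy))).2.1)
      (Finset.card_image_le.trans hd) (fun i => x.testBit i)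
    exact ⟨h, fun y hy => hh _ (Finset.mem_image_of_mem _ hy)⟩
  have hne : Nonempty (Fin l) := ⟨⟨0, hl⟩⟩
  choose! h hh using key
  have hcard : Fintype.card (BitTest d l) = l ^ (d * d) * 2 ^ 2 ^ (d * d) := by simp [BitTest]
  refine ⟨fun x X => Fintype.equivFin (BitTest d l) (h x X), ⟨?_, ?_⟩⟩
  · intro x hx X hX hxX hd
    rw [← hcard]
    exact Fin.is_lt _
  · intro x hx y hy X hX Y hY hxX hyY hdX hdY hyX hxY heq
    have heq : h x X = h y Y := (Fintype.equivFin _).injective (Fin.ext heq)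
    have h1 := hh x hx X hX hxX hdX y hyX
    have h2 := hh y hy Y hY hyY hdY x hxY
    obtain ⟨g1, -, g3⟩ := hδ x hx y hy (fun h => hyY (h ▸ hxY))
    rw [← heq, ← g1] at h2
    exact g3 (h1.symm.trans h2)

/-! ### Composing reductions: from identifiers to polynomially many colors in the degree. -/

/-- `T` rounds reduce the number of colors from `m` to `m'`, without ever increasing it. -/
inductive ReducesIn (d : ℕ) : ℕ → ℕ → ℕ → Prop
  | refl (m : ℕ) : ReducesIn d 0 m m
  | step {T m m₁ m' : ℕ} (g : ℕ → Finset ℕ → ℕ) (hg : IsReduction d m m₁ g) (hle : m₁ ≤ m)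
      (h : ReducesIn d T m₁ m') : ReducesIn d (T + 1) m m'

/-- At most `T` rounds reduce the number of colors from `m` to at most `B`. -/
def ReducesWithin (d T m B : ℕ) : Prop := ∃ T' ≤ T, ∃ m' ≤ B, ReducesIn d T' m m'

theorem ReducesWithin.of_le {d m B : ℕ} (h : m ≤ B) (T : ℕ) : ReducesWithin d T m B :=
  ⟨0, Nat.zero_le _, m, h, ReducesIn.refl m⟩

theorem ReducesWithin.of_isReduction {d m B : ℕ} {g : ℕ → Finset ℕ → ℕ}
    (hg : IsReduction d m B g) : ReducesWithin d 1 m B := by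
  rcases le_total m B with h | h
  · exact ReducesWithin.of_le h 1
  · exact ⟨1, le_rfl, B, le_rfl, ReducesIn.step g hg h (ReducesIn.refl B)⟩

theorem ReducesIn.trans {d T₁ T₂ m m₁ m₂ : ℕ} (h₁ : ReducesIn d T₁ m m₁)
    (h₂ : ReducesIn d T₂ m₁ m₂) : ReducesIn d (T₁ + T₂) m m₂ := by
  induction h₁ with
  | refl m => simpa using h₂
  | step g hg hle _ ih =>
    rw [Nat.add_right_comm]
    exact ReducesIn.step g hg hle (ih h₂)

theorem ReducesWithin.trans {d T₁ T₂ m B₁ B₂ : ℕ} (h₁ : ReducesWithin d T₁ m B₁)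
    (h₂ : ∀ m' ≤ B₁, ReducesWithin d T₂ m' B₂) : ReducesWithin d (T₁ + T₂) m B₂ := by
  obtain ⟨t₁, ht₁, m₁, hm₁, r₁⟩ := h₁
  obtain ⟨t₂, ht₂, m₂, hm₂, r₂⟩ := h₂ m₁ hm₁
  exact ⟨t₁ + t₂, by omega, m₂, hm₂, r₁.trans r₂⟩

/-- Polynomials of degree `μ` suffice because `2 ^ μ ≤ q ^ μ`, and a prime `q` just above `μ * d +
1` leaves a point free of conflicts. -/
theorem reducesWithin_linial {d m μ : ℕ} (hμ : 1 ≤ μ) (hm : m ≤ 2 ^ μ) :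
    ReducesWithin d 1 m (4 * (μ * d + 1) ^ 2) := by
  obtain ⟨q, hq, h1, h2⟩ := Nat.exists_prime_lt_and_le_two_mul (μ * d + 1) (by omega)
  obtain ⟨f, hf⟩ := exists_isCodeFamily m q μ hq hμ (hm.trans (Nat.pow_le_pow_left hq.two_le _))
  obtain ⟨g, hg⟩ := hf.exists_isReduction (d := d) (by omega)
  refine (ReducesWithin.of_isReduction hg).trans (T₂ := 0) fun m' hm' => .of_le (hm'.trans ?_) 0
  calc q * q ≤ (2 * (μ * d + 1)) * (2 * (μ * d + 1)) := Nat.mul_le_mul h2 h2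
    _ = _ := by ring

theorem reducesWithin_linial_two_pow {d m ν : ℕ} (hd : d + 2 ≤ ν) (hm : m ≤ 2 ^ 2 ^ ν) :
    ReducesWithin d 1 m (2 ^ (4 * ν + 2)) := by
  refine (reducesWithin_linial Nat.one_le_two_pow hm).trans (T₂ := 0)
    fun m' hm' => .of_le (hm'.trans ?_) 0
  have h0 : ν < 2 ^ ν := Nat.lt_two_pow_self
  have h1 : 2 ^ ν * d + 1 ≤ 2 ^ ν * 2 ^ ν := by
    calc 2 ^ ν * d + 1 ≤ 2 ^ ν * (d + 1) := by
          have := Nat.one_le_two_pow (n := ν)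
          rw [mul_add]; omega
      _ ≤ _ := Nat.mul_le_mul_left _ (by omega)
  calc 4 * (2 ^ ν * d + 1) ^ 2 ≤ 4 * (2 ^ ν * 2 ^ ν) ^ 2 := by gcongr
    _ = _ := by ring

/-- Restores the doubly exponential form needed to apply `reducesWithin_linial_two_pow` again. -/
theorem two_pow_add_le_two_pow (x y : ℕ) : 4 * 2 ^ x + y ≤ 2 ^ (x + y + 3) := by
  have h1 : y < 2 ^ y := Nat.lt_two_pow_self
  have h2 : 1 ≤ 2 ^ x := Nat.one_le_two_pow
  have h3 : 2 ^ (x + y + 3) = 8 * (2 ^ x * 2 ^ y) := by ring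
  rw [h3]
  have h4 : 2 ^ x * 1 ≤ 2 ^ x * 2 ^ y := Nat.mul_le_mul_left _ (by omega)
  have h5 : 1 * 2 ^ y ≤ 2 ^ x * 2 ^ y := Nat.mul_le_mul_right _ (by omega)
  omega

section LogStar

/-- The iterated logarithm bounds the number of rounds until the number of colors is bounded in
terms of the degree. -/
theorem reducesWithin_logStar_aux (d D : ℕ) (hD : 2 * (d * d) + 1 ≤ D) (s : ℕ) :
    ∀ a : ℝ, 1 ≤ a → (Real.logb 2)^[s] a ≤ 1 → ∀ m : ℕ, (m : ℝ) ≤ a ^ D →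
      ReducesWithin d (s / 2) m (2 ^ (D * 2 ^ (2 ^ 2 ^ (d * d) + D + 2))) := by
  induction s using Nat.strong_induction_on with
  | _ s ih =>
  intro a ha hs m hm
  set P : ℕ := 2 ^ 2 ^ (d * d) with hP
  set Z : ℕ := P + D + 2 with hZ
  set y : ℝ := Real.logb 2 (Real.logb 2 a) with hy
  -- Below the threshold `Z` the target is already met with no round. Above it, `y` dominates `P`
  -- and `D + 2`, so one bit-test round replaces `a` by `y = log log a` and uses up two iterations
  -- of the logarithm.
  by_cases hyZ : y < Z
  · refine .of_le ?_ _
    have h1 : a ≤ 2 ^ 2 ^ Z := by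
      rcases ha.eq_or_lt with h | h
      · rw [← h]
        exact one_le_pow₀ (by norm_num)
      · have h2 : 0 < Real.logb 2 a := Real.logb_pos (by norm_num) h
        rw [hy, Real.logb_lt_iff_lt_rpow (by norm_num) h2, Real.rpow_natCast,
          Real.logb_lt_iff_lt_rpow (by norm_num) (by linarith)] at hyZ
        refine hyZ.le.trans (le_of_eq ?_)
        rw [show ((2 : ℝ) ^ Z) = ((2 ^ Z : ℕ) : ℝ) by push_cast; rfl, Real.rpow_natCast]
    have h2 : (m : ℝ) ≤ ((2 ^ (D * 2 ^ Z) : ℕ) : ℝ) := by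
      refine hm.trans ((pow_le_pow_left₀ (by linarith) h1 D).trans (le_of_eq ?_))
      rw [← pow_mul, mul_comm]
      push_cast
      rfl
    exact_mod_cast h2
  · push Not at hyZ
    have hZ3 : (3 : ℝ) ≤ Z := by
      have : 1 ≤ P := Nat.one_le_two_pow
      have : 3 ≤ Z := by omega
      exact_mod_cast this
    have hy3 : 3 ≤ y := hZ3.trans hyZ
    set z : ℝ := Real.logb 2 a with hz
    have hz0 : 0 ≤ z := Real.logb_nonneg (by norm_num) ha
    have hz1 : 1 < z := by
      by_contra hc
      push Not at hc
      have := Real.logb_nonpos (b := 2) (by norm_num) hz0 hc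
      linarith
    have ha1 : 1 < a := by
      by_contra hc
      have : a = 1 := by linarith
      rw [hz, this, Real.logb_one] at hz1
      linarith
    obtain ⟨s', rfl⟩ : ∃ s', s = s' + 2 := by
      match s, hs with
      | 0, hs => simp at hs; linarith
      | 1, hs => simp at hs; linarith
      | s' + 2, _ => exact ⟨s', rfl⟩
    have hs' : (Real.logb 2)^[s'] y ≤ 1 := by
      simpa [Function.iterate_succ_apply] using hs
    -- number of bits
    set k : ℕ := ⌈D * z⌉₊ with hk
    set l : ℕ := ⌈1 + D + y⌉₊ with hl
    have hza : a = 2 ^ z := (Real.rpow_logb (by norm_num) (by norm_num) (by linarith)).symm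
    have hyz : z = 2 ^ y := (Real.rpow_logb (by norm_num) (by norm_num) (by linarith)).symm
    have hmk : m ≤ 2 ^ k := by
      have : (m : ℝ) ≤ ((2 ^ k : ℕ) : ℝ) := by
        refine hm.trans ?_
        rw [hza, ← Real.rpow_natCast, ← Real.rpow_mul (by norm_num)]
        push_cast
        rw [← Real.rpow_natCast]
        refine Real.rpow_le_rpow_of_exponent_le (by norm_num) ?_
        rw [mul_comm]
        exact Nat.le_ceil _
      exact_mod_cast this
    have hD1 : (1 : ℝ) ≤ D := by
      have : 1 ≤ D := by omega
      exact_mod_cast this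
    have hkl : k ≤ 2 ^ l := by
      have h1 : (k : ℝ) ≤ ((2 ^ l : ℕ) : ℝ) := by
        have h2 : (k : ℝ) ≤ D * z + 1 := (Nat.ceil_lt_add_one (by positivity)).le
        have h3 : D * z + 1 ≤ 2 * (D * z) := by nlinarith
        have h4 : (D : ℝ) ≤ 2 ^ D := by
          have : D ≤ 2 ^ D := Nat.lt_two_pow_self.le
          exact_mod_cast this
        calc (k : ℝ) ≤ 2 * (D * z) := h2.trans h3
          _ ≤ 2 * (2 ^ D * z) := by gcongr
          _ = 2 ^ (1 + D + y : ℝ) := by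
              rw [Real.rpow_add (by norm_num), Real.rpow_add (by norm_num), ← hyz,
                Real.rpow_one, Real.rpow_natCast]
              ring
          _ ≤ 2 ^ (l : ℝ) := Real.rpow_le_rpow_of_exponent_le (by norm_num) (Nat.le_ceil _)
          _ = _ := by rw [Real.rpow_natCast]; push_cast; rfl
      exact_mod_cast h1
    have hl0 : 0 < l := Nat.ceil_pos.2 (by linarith)
    obtain ⟨g, hg⟩ := exists_isReduction_bitTest (d := d) hmk hkl hl0
    have hT : (s' + 2) / 2 = 1 + s' / 2 := by omega
    rw [hT]
    refine (ReducesWithin.of_isReduction hg).trans fun m' hm' => ih s' (by omega) y (by linarith)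
      hs' m' ?_
    have hly : (l : ℝ) ≤ y * y := by
      have h1 : (l : ℝ) ≤ 1 + D + y + 1 := (Nat.ceil_lt_add_one (by linarith)).le
      have h2 : (D : ℝ) + 2 ≤ y := by
        refine le_trans ?_ hyZ
        rw [hZ]; push_cast
        have : (0 : ℝ) ≤ (P : ℝ) := Nat.cast_nonneg _
        linarith
      nlinarith
    have hPy : ((P : ℕ) : ℝ) ≤ y := by
      refine le_trans ?_ hyZ
      have : P ≤ Z := by omega
      exact_mod_cast this
    have h5 : (m' : ℝ) ≤ (l : ℝ) ^ (d * d) * (P : ℝ) := by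
      have : m' ≤ l ^ (d * d) * P := hm'
      exact_mod_cast this
    -- The exponent `2 * (d * d) + 1` reached here is the reason for the hypothesis `hD`.
    calc (m' : ℝ) ≤ (l : ℝ) ^ (d * d) * (P : ℝ) := h5
      _ ≤ (y * y) ^ (d * d) * y := by gcongr
      _ = y ^ (2 * (d * d) + 1) := by ring
      _ ≤ y ^ D := pow_le_pow_right₀ (by linarith) hD

theorem reducesWithin_logStar (d D n : ℕ) (hD : 2 * (d * d) + 1 ≤ D) (m : ℕ) (hm : m ≤ (max n 1) ^ D) :
    ReducesWithin d (logStar n / 2) m (2 ^ (D * 2 ^ (2 ^ 2 ^ (d * d) + D + 2))) := by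
  classical
  have hspec : (Real.logb 2)^[logStar n] (n : ℝ) ≤ 1 := Nat.find_spec (exists_iterate_logb_le_one n)
  rcases Nat.eq_zero_or_pos n with rfl | hn
  · refine .of_le ?_ _
    simp only [zero_le, sup_of_le_right, one_pow] at hm
    exact hm.trans Nat.one_le_two_pow
  · refine reducesWithin_logStar_aux d D hD _ n (by exact_mod_cast hn) hspec m ?_
    rw [max_eq_left hn] at hm
    exact_mod_cast hm

end LogStar

/-- Within `log* n / 2 + O(1)` rounds, identifiers are reduced to polynomially many colors in the
degree. -/
theorem exists_reducesWithin_pow (k : ℕ) : ∃ b, ∀ n d,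
    ReducesWithin d (logStar n / 2 + 4) (n ^ k) ((d + 2) ^ b) := by
  refine ⟨8 + 2 * (400 + 128 * k), fun n d => ?_⟩
  set E := d * d with hE
  set D := 2 * E + 1 + k with hD
  have hdE : d ≤ E := Nat.le_mul_self d
  have hE1 : 1 ≤ 2 ^ E := Nat.one_le_two_pow
  have hE2 : 1 ≤ 2 ^ 2 ^ E := Nat.one_le_two_pow
  have hnk : n ^ k ≤ (max n 1) ^ D := by
    calc n ^ k ≤ (max n 1) ^ k := Nat.pow_le_pow_left (le_max_left _ _) _
      _ ≤ _ := Nat.pow_le_pow_right (by omega) (by omega)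
  refine (reducesWithin_logStar d D n (by omega) (n ^ k) hnk).trans fun m₀ h₀ => ?_
  have h₀' : m₀ ≤ 2 ^ 2 ^ (2 ^ 2 ^ E + 2 * D + 2) := by
    refine h₀.trans (Nat.pow_le_pow_right (by norm_num) ?_)
    calc D * 2 ^ (2 ^ 2 ^ E + D + 2) ≤ 2 ^ D * 2 ^ (2 ^ 2 ^ E + D + 2) :=
          Nat.mul_le_mul_right _ Nat.lt_two_pow_self.le
      _ = _ := by rw [← pow_add]; congr 1; ring
  -- Each of the four Linial rounds removes one exponential: exponents of order `2 ^ 2 ^ 2 ^ E`, `2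
  -- ^ 2 ^ E`, `2 ^ E`, `E`, and finally a polynomial in `d`.
  refine (reducesWithin_linial_two_pow (by omega) h₀').trans (T₂ := 3) fun m₁ h₁ => ?_
  have h₁' : m₁ ≤ 2 ^ 2 ^ (2 ^ E + (8 * D + 10) + 3) := by
    refine h₁.trans (Nat.pow_le_pow_right (by norm_num) (le_trans (le_of_eq ?_)
      (two_pow_add_le_two_pow (2 ^ E) (8 * D + 10))))
    ring
  refine (reducesWithin_linial_two_pow (by omega) h₁').trans (T₂ := 2) fun m₂ h₂ => ?_
  have h₂' : m₂ ≤ 2 ^ 2 ^ (E + (32 * D + 54) + 3) := by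
    refine h₂.trans (Nat.pow_le_pow_right (by norm_num) (le_trans (le_of_eq ?_)
      (two_pow_add_le_two_pow E (32 * D + 54))))
    ring
  refine (reducesWithin_linial_two_pow (by omega) h₂').trans (T₂ := 1) fun m₃ h₃ => ?_
  refine (reducesWithin_linial (by omega) h₃).trans (T₂ := 0) fun m₄ h₄ => .of_le (h₄.trans ?_) 0
  set c := 400 + 128 * k with hc
  have h5 : (4 * (E + (32 * D + 54) + 3) + 2) * d + 1 ≤ c * (d + 2) ^ 3 := by
    rw [hc, hD, hE]
    ring_nf
    nlinarith [Nat.zero_le (k * d ^ 3), Nat.zero_le (k * d ^ 2), Nat.zero_le (d ^ 3),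
      Nat.zero_le (k * d), Nat.zero_le (d ^ 2)]
  have hcN : c ≤ (d + 2) ^ c :=
    Nat.lt_two_pow_self.le.trans (Nat.pow_le_pow_left (by omega) c)
  have h4N : 4 ≤ (d + 2) ^ 2 := by nlinarith
  calc _ ≤ 4 * (c * (d + 2) ^ 3) ^ 2 := by gcongr
    _ ≤ (d + 2) ^ 2 * ((d + 2) ^ c * (d + 2) ^ 3) ^ 2 := by gcongr
    _ = (d + 2) ^ (8 + 2 * c) := by
      generalize d + 2 = N
      rw [mul_pow, ← pow_mul, ← pow_mul, ← pow_add, ← pow_add]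
      congr 1
      ring

/-! ### Executing color reductions as rules. -/

section ReductionRules

variable {C V : Type} [Fintype V] {G : SimpleGraph V} [DecidableRel G.Adj] {L : V → Finset C}

/-- Recolor according to a color reduction. -/
def reductionRule {C : Type} (g : ℕ → Finset ℕ → ℕ) : RoundRule C := fun _ s nbrs =>
  ⟨{ s.vars with color := g s.vars.color (nbrs.map fun y => y.vars.color).toFinset }, s.palette⟩

/-- The graph is properly colored from `{0, ..., m - 1}` and all nodes are undecided. -/
structure ColoringInvariant (G : SimpleGraph V) (M m : ℕ) (s : V → NodeState C) : Prop where
  bounded : ∀ v, (s v).vars.Bounded M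
  color_lt : ∀ v, (s v).vars.color < m
  color_ne : ∀ u v, G.Adj u v → (s u).vars.color ≠ (s v).vars.color
  status : ∀ v, (s v).vars.status = 0
  palette_empty : ∀ v, (s v).palette = ∅

theorem ColoringInvariant.reduce {d m m' M : ℕ} {g : ℕ → Finset ℕ → ℕ} (hg : IsReduction d m m' g)
    (hm : m' ≤ M) (hd : ∀ v, G.degree v ≤ d) {s : V → NodeState C}
    (h : ColoringInvariant G M m s) :
    ColoringInvariant G M m' (runRound M G L s (reductionRule g)) := by
  classical
  set X : V → Finset ℕ := fun v => (G.neighborFinset v).image fun u => (s u).vars.color with hX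
  have hXm : ∀ v, X v ⊆ Finset.range m := by
    intro v x hx
    obtain ⟨u, -, rfl⟩ := Finset.mem_image.1 hx
    exact Finset.mem_range.2 (h.color_lt u)
  have hXn : ∀ v, (s v).vars.color ∉ X v := by
    intro v hx
    obtain ⟨u, hu, hux⟩ := Finset.mem_image.1 hx
    exact h.color_ne v u (by simpa using hu) hux.symm
  have hXd : ∀ v, (X v).card ≤ d := fun v =>
    Finset.card_image_le.trans (by rw [G.card_neighborFinset_eq_degree]; exact hd v)
  have hlt : ∀ v, g (s v).vars.color (X v) < m' := fun v =>
    hg.lt _ (h.color_lt v) _ (hXm v) (hXn v) (hXd v)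
  have hs : ∀ v, runRound M G L s (reductionRule g) v =
      ⟨{ (s v).vars with color := g (s v).vars.color (X v) }, (s v).palette⟩ := by
    intro v
    have hr : reductionRule g (L v) (s v) ((G.neighborFinset v).val.map s) =
        ⟨{ (s v).vars with color := g (s v).vars.color (X v) }, (s v).palette⟩ := by
      simp only [reductionRule, Multiset.map_map]
      congr 3
    rw [runRound_eq, hr]
    rw [hr]
    exact Or.inr (Or.inl ⟨rfl, (hlt v).trans_le hm, (h.bounded v).2⟩)
  refine ⟨fun v => ?_, fun v => ?_, fun u v huv => ?_, fun v => ?_, fun v => ?_⟩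
  · rw [hs]; exact ⟨(hlt v).trans_le hm, (h.bounded v).2⟩
  · rw [hs]; exact hlt v
  · rw [hs, hs]
    exact hg.ne _ (h.color_lt u) _ (h.color_lt v) _ (hXm u) _ (hXm v) (hXn u) (hXn v) (hXd u)
      (hXd v) (Finset.mem_image.2 ⟨v, by simpa using huv, rfl⟩)
      (Finset.mem_image.2 ⟨u, by simpa using huv.symm, rfl⟩)
  · rw [hs]; exact h.status v
  · rw [hs]; exact h.palette_empty v

/-- A sequence of color reductions can be executed by nodes that know their neighbors' states. -/
theorem ReducesIn.exists_rules (C : Type) {d T m m' : ℕ} (h : ReducesIn d T m m') (M : ℕ)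
    (hM : m ≤ M) : ∃ prog : List (RoundRule C), prog.length = T ∧
      ∀ (V : Type) [Fintype V] (G : SimpleGraph V) [DecidableRel G.Adj] (L : V → Finset C)
        (s : V → NodeState C), (∀ v, G.degree v ≤ d) → ColoringInvariant G M m s →
        ColoringInvariant G M m' (run M G L prog s) := by
  induction h with
  | refl m => exact ⟨[], rfl, fun V _ G _ L s _ hs => hs⟩
  | step g hg hle _ ih =>
    obtain ⟨prog, hlen, hprog⟩ := ih (by omega)
    refine ⟨reductionRule g :: prog, by simp [hlen], fun V _ G _ L s hd hs => ?_⟩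
    exact hprog V G L _ hd (hs.reduce hg (by omega) hd)

end ReductionRules

/-! ### Parameters of the candidate families. -/

section Parameters

theorem pow_self_le_three_pow_mul_factorial (j : ℕ) : j ^ j ≤ 3 ^ j * j.factorial := by
  have h1 : (j : ℝ) ^ j / j.factorial ≤ Real.exp j :=
    Real.pow_div_factorial_le_exp (j : ℝ) (Nat.cast_nonneg j) j
  have h2 : Real.exp j ≤ 3 ^ j := by
    rw [← Real.exp_one_rpow, Real.rpow_natCast]
    exact pow_le_pow_left₀ (Real.exp_pos 1).le Real.exp_one_lt_three.le j
  have h3 : (j : ℝ) ^ j ≤ 3 ^ j * j.factorial := by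
    have hf : (0 : ℝ) < j.factorial := by exact_mod_cast j.factorial_pos
    exact (div_le_iff₀ hf).1 (h1.trans h2)
  exact_mod_cast h3

theorem choose_le_three_mul_pow {n j β : ℕ} (h : n ≤ β * j) : n.choose j ≤ (3 * β) ^ j := by
  refine Nat.le_of_mul_le_mul_left ?_ j.factorial_pos
  calc j.factorial * n.choose j = n.descFactorial j := (Nat.descFactorial_eq_factorial_mul_choose n j).symm
    _ ≤ n ^ j := Nat.descFactorial_le_pow n j
    _ ≤ (β * j) ^ j := Nat.pow_le_pow_left h j
    _ = β ^ j * j ^ j := mul_pow ..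
    _ ≤ β ^ j * (3 ^ j * j.factorial) := Nat.mul_le_mul_left _ (pow_self_le_three_pow_mul_factorial j)
    _ = _ := by rw [mul_pow]; ring

/-- The intersection threshold `σ = τ + 1` of order `log N` makes `4 ^ σ` absorb the factor `6 * β²
* g`, which is polynomial in `N` up to a factor `σ`. The list size `l` then exceeds `β²` only by a
logarithmic factor. -/
theorem exists_isListFamily_of_pow {C : Type} [DecidableEq C] [Fintype C] (b e N m β : ℕ)
    (hN₁ : 6 * (2 * b + 25) ≤ N) (hN₂ : 2 * (e + 3) ≤ N) (hC : Fintype.card C ≤ 2 ^ N ^ e)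
    (hm : m ≤ N ^ b) (hβ : 1 ≤ β) (hβN : β * β ≤ N) :
    ∃ l R τ F, IsListFamily (C := C) m β l R τ F ∧ 1 ≤ l ∧
      l ≤ 12 * (β * β) * (2 * (e + 3) * Nat.log 2 N) ∧ R ≤ N ^ (e + 5) := by
  set lam := Nat.log 2 N with hlam
  have hlam1 : 1 ≤ lam := Nat.le_log_of_pow_le (by norm_num) (by omega)
  set σ := 2 * (e + 3) * lam with hσ
  have hσ1 : 1 ≤ σ := by rw [hσ]; nlinarith
  obtain ⟨τ, hτ⟩ : ∃ τ, σ = τ + 1 := ⟨σ - 1, by omega⟩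
  set k := β * τ + 1 with hk
  have hkσ : k ≤ β * σ := by rw [hτ, hk, mul_add]; omega
  -- The factor `12 = 3 * 4`: `3 * β` comes from the bound on the binomial coefficient, and `4` pays
  -- for `6 * β² * g ≤ 4 ^ σ`.
  set s := 12 * β with hs
  set l := k * s with hl
  have hlσ : l ≤ 12 * (β * β) * σ := by
    calc l ≤ β * σ * s := Nat.mul_le_mul_right _ hkσ
      _ = _ := by rw [hs]; ring
  -- Chosen so that `2 ^ g` exceeds the squared number of pairs of color and arranged list.
  set g := 2 * (N * b + l * N ^ e) + 1 with hg
  set R := β * g with hR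
  have hNpow : N ^ (e + 3) ≤ 2 ^ σ := by
    calc N ^ (e + 3) ≤ (2 ^ (lam + 1)) ^ (e + 3) :=
          Nat.pow_le_pow_left (Nat.lt_pow_succ_log_self (by norm_num) N).le _
      _ ≤ (2 ^ (2 * lam)) ^ (e + 3) := by gcongr <;> omega
      _ = 2 ^ σ := by rw [← pow_mul, hσ]; congr 1; ring
  have hNe : N ≤ N ^ (e + 1) := Nat.le_self_pow (by omega) N
  have hgle : 6 * (β * β) * g ≤ N ^ (e + 3) * σ := by
    have h1 : l * N ^ e ≤ 12 * N ^ (e + 1) * σ := by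
      calc l * N ^ e ≤ (12 * N * σ) * N ^ e := by
            refine Nat.mul_le_mul_right _ (hlσ.trans ?_)
            gcongr
        _ = _ := by ring
    have h2 : N * b ≤ b * N ^ (e + 1) * σ := by
      calc N * b ≤ N ^ (e + 1) * b * σ := by
            refine le_trans ?_ (Nat.le_mul_of_pos_right _ hσ1)
            gcongr
        _ = _ := by ring
    have h3 : 1 ≤ N ^ (e + 1) * σ := Nat.mul_pos (Nat.pow_pos (by omega)) hσ1
    have h4 : g ≤ (2 * b + 25) * (N ^ (e + 1) * σ) := by
      rw [hg]
      nlinarith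
    calc 6 * (β * β) * g ≤ 6 * N * ((2 * b + 25) * (N ^ (e + 1) * σ)) := by gcongr
      _ = (6 * (2 * b + 25)) * (N ^ (e + 2) * σ) := by ring
      _ ≤ N * (N ^ (e + 2) * σ) := Nat.mul_le_mul_right _ hN₁
      _ = _ := by ring
  have h4σ : 6 * (β * β) * g ≤ 4 ^ σ := by
    calc _ ≤ N ^ (e + 3) * σ := hgle
      _ ≤ 2 ^ σ * 2 ^ σ := Nat.mul_le_mul hNpow Nat.lt_two_pow_self.le
      _ = 4 ^ σ := by rw [← mul_pow]; norm_num
  obtain ⟨F, hF⟩ := exists_isListFamily (C := C) m β τ s R g (2 ^ g) (by omega)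
    (Nat.le_mul_of_pos_left _ hβ) (by rw [hR]; exact Nat.mul_lt_mul_of_pos_left (by omega) hβ)
    (by omega)
    (by
      have h1 : m ≤ 2 ^ (N * b) := hm.trans (by
        rw [pow_mul]; exact Nat.pow_le_pow_left Nat.lt_two_pow_self.le b)
      calc _ ≤ (2 ^ (N * b) * (2 ^ N ^ e) ^ l) ^ 2 := by gcongr
        _ = 2 ^ (2 * (N * b + l * N ^ e)) := by
            rw [← pow_mul, ← pow_add, ← pow_mul]; congr 1; ring
        _ < 2 ^ g := Nat.pow_lt_pow_right (by norm_num) (by omega))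
    (by
      rw [← hτ, ← hk]
      have h1 : R.choose g ≤ (3 * β) ^ g := choose_le_three_mul_pow le_rfl
      have h2 : k.choose σ ≤ (3 * β) ^ σ := choose_le_three_mul_pow hkσ
      calc _ ≤ (3 * β) ^ g * (R * (3 * β) ^ σ) ^ g * 2 ^ g := by gcongr
        _ = (6 * (β * β) * g * (3 * β) ^ σ) ^ g := by
            rw [← mul_pow, ← mul_pow, hR]; congr 1; ring
        _ ≤ (4 ^ σ * (3 * β) ^ σ) ^ g := by gcongr
        _ = _ := by rw [← mul_pow, hs]; congr 2; ring)
  refine ⟨l, R, τ, F, hF, Nat.mul_pos (by omega) (by omega), hlσ, ?_⟩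
  have hlamN : lam ≤ N := Nat.log_le_self 2 N
  calc R ≤ 6 * (β * β) * g := by
        rw [hR]
        refine Nat.mul_le_mul_right _ ?_
        nlinarith
    _ ≤ N ^ (e + 3) * σ := hgle
    _ ≤ N ^ (e + 3) * (N * N) := by rw [hσ]; gcongr
    _ = _ := by ring

/-- For `β = 0` there are no opponents, so a single available color is a valid list. -/
theorem isListFamily_zero {C : Type} [DecidableEq C] (m : ℕ) :
    IsListFamily (C := C) m 0 1 1 0 fun _ S _ => S := by
  refine ⟨fun _ _ S _ _ _ => subset_rfl, fun _ _ S hS _ _ => by omega,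
    fun x _ S _ Y hY _ => ⟨0, by norm_num, fun y hy => ?_⟩⟩
  rw [Nat.le_zero, Finset.card_eq_zero] at hY
  simp [hY] at hy

end Parameters

/-! ### Sequences of stages and their total length. -/

section Phases

open Classical

/-- Some program of at most `T` rounds completes all partial list colorings whose uncolored nodes
have at most `δ` uncolored neighbors, if proper colorings with `m` colors are given. -/
def ColorsWithin (C : Type) [Nonempty C] (M m δ : ℕ) (T : ℝ) : Prop :=
  ∃ prog : List (RoundRule C), (prog.length : ℝ) ≤ T ∧
    ∀ (V : Type) [Fintype V] (G : SimpleGraph V) [DecidableRel G.Adj] (L : V → Finset C)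
      (s : V → NodeState C), (∀ v, G.degree v + 1 ≤ (L v).card) → StageInvariant G L M m δ s →
      Consistent G L M m (run M G L prog s) ∧ ∀ v, (run M G L prog s v).vars.status = 3

variable {C : Type} [Nonempty C]

theorem ColorsWithin.mono {M m δ : ℕ} {T T' : ℝ} (h : ColorsWithin C M m δ T) (hT : T ≤ T') :
    ColorsWithin C M m δ T' := by
  obtain ⟨prog, hlen, hp⟩ := h
  exact ⟨prog, hlen.trans hT, hp⟩

/-- With `β = 0` the uncolored nodes of a class are pairwise nonadjacent, so each simply takes an
available color. As `l = 1`, one stage colors everything. -/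
theorem colorsWithin_of_prime {M m δ q D : ℕ} (hq : q.Prime) (hD : 1 ≤ D) (hm : m ≤ q ^ D)
    (hqδ : 2 * D * δ < q) (hM : q + 6 ≤ M) : ColorsWithin C M m δ (4 * q + 1) := by
  obtain ⟨f, hf⟩ := exists_isCodeFamily m q D hq hD hm
  refine ⟨stageRules f (fun _ S _ => S) 0 q 1 1 0, by rw [length_stageRules]; push_cast; rfl,
    fun V _ G _ L s hL hs => ?_⟩
  obtain ⟨h1, h2⟩ := run_stageRules hf (by omega) (isListFamily_zero m) le_rfl (by omega)
    (by omega) hL hs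
  refine ⟨h1.toConsistent, fun v => ?_⟩
  rcases h1.status v with h | h
  · have := h2 v h
    omega
  · exact h

theorem ColorsWithin.of_stage {M m δ δ' q D β l R τ : ℕ} {F : ℕ → Finset C → ℕ → Finset C} {T : ℝ}
    (hq : q.Prime) (hD : 1 ≤ D) (hm : m ≤ q ^ D) (hqδ : 2 * D * δ < q * (β + 1))
    (hF : IsListFamily m β l R τ F) (hl : 1 ≤ l) (hM₁ : q + 4 ≤ M) (hM₂ : l + R + 4 ≤ M)
    (hlδ : l - 2 ≤ δ') (h : ColorsWithin C M m δ' T) :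
    ColorsWithin C M m δ (4 * q + 1 + T) := by
  obtain ⟨f, hf⟩ := exists_isCodeFamily m q D hq hD hm
  obtain ⟨prog, hlen, hp⟩ := h
  refine ⟨stageRules f F β q l R τ ++ prog, ?_, fun V _ G _ L s hL hs => ?_⟩
  · rw [List.length_append, length_stageRules]
    push_cast
    linarith
  · rw [run_append]
    have h1 := (run_stageRules hf hqδ hF hl hM₁ hM₂ hL hs).1
    exact hp V G L _ hL ⟨h1.toConsistent, h1.status, fun v hv => (h1.degree_le v hv).trans hlδ⟩

/-- Ensures that `δ ^ 8 ≥ N` leaves room for `β ≥ 1` in a halving stage. -/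
theorem exists_pow_log_le (c : ℕ) : ∃ N₀, ∀ N ≥ N₀, (c * Nat.log 2 N) ^ 8 ≤ N := by
  have h := tendsto_pow_const_div_const_pow_of_one_lt 8 (r := (2 : ℝ)) (by norm_num)
  have h2 := h.eventually (gt_mem_nhds (show (0 : ℝ) < 1 / (c ^ 8 + 1) by positivity))
  obtain ⟨Λ, hΛ⟩ := Filter.eventually_atTop.1 h2
  refine ⟨2 ^ Λ, fun N hN => ?_⟩
  have hN0 : N ≠ 0 := by
    have := Nat.one_le_two_pow (n := Λ)
    omega
  have h3 := hΛ (Nat.log 2 N) (Nat.le_log_of_pow_le (by norm_num) hN)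
  have h4 : (2 : ℝ) ^ Nat.log 2 N ≤ N := by
    exact_mod_cast Nat.pow_log_le_self 2 hN0
  rw [div_lt_div_iff₀ (by positivity) (by positivity), one_mul] at h3
  have h5 : (((c * Nat.log 2 N) ^ 8 : ℕ) : ℝ) ≤ (N : ℝ) := by
    push_cast
    rw [mul_pow]
    have : (0 : ℝ) ≤ (Nat.log 2 N : ℝ) ^ 8 := by positivity
    nlinarith
  exact_mod_cast h5

/-- The number of rounds of a stage. -/
theorem four_mul_prime_add_one_le {D δ β q Q σ : ℕ} (hQ : Q = 2 * D * δ / (β + 1) + 1)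
    (hq : q ≤ 2 * Q) (hβ : δ < (β + 1) ^ 2 * σ) (hδ : 1 ≤ δ) (hσ : 1 ≤ σ) :
    (4 * q + 1 : ℝ) ≤ (16 * D + 9) * Real.sqrt (δ * σ) := by
  have h1 : (q : ℝ) ≤ 2 * (2 * D * δ / (β + 1) + 1) := by
    have h2 : ((2 * D * δ / (β + 1) : ℕ) : ℝ) ≤ 2 * D * δ / (β + 1) := by
      have := Nat.cast_div_le (α := ℝ) (m := 2 * D * δ) (n := β + 1)
      push_cast at this
      exact this
    have h3 : (q : ℝ) ≤ 2 * (Q : ℝ) := by exact_mod_cast hq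
    rw [hQ] at h3
    push_cast at h3 h2
    linarith
  have hs1 : 1 ≤ Real.sqrt (δ * σ) := by
    rw [Real.one_le_sqrt]
    have h2 : (1 : ℝ) ≤ δ := by exact_mod_cast hδ
    have h3 : (1 : ℝ) ≤ σ := by exact_mod_cast hσ
    nlinarith
  have h4 : (δ : ℝ) / (β + 1) ≤ Real.sqrt (δ * σ) := by
    apply Real.le_sqrt_of_sq_le
    rw [div_pow, div_le_iff₀ (by positivity)]
    have h5 : (δ : ℝ) ≤ (β + 1) ^ 2 * σ := by exact_mod_cast hβ.le
    calc (δ : ℝ) ^ 2 = δ * δ := sq _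
      _ ≤ δ * ((β + 1) ^ 2 * σ) := by gcongr
      _ = _ := by ring
  calc (4 * q + 1 : ℝ) ≤ 16 * D * (δ / (β + 1)) + 9 := by
        have : (2 * D * δ / (β + 1) : ℝ) = 2 * D * (δ / (β + 1)) := by ring
        rw [this] at h1
        linarith
    _ ≤ 16 * D * Real.sqrt (δ * σ) + 9 * Real.sqrt (δ * σ) := by
        gcongr
        linarith
    _ = _ := by ring

theorem le_sq_of_lt_mul_of_sq_le {δ q β : ℕ} (h : δ < q * β) (hβ : β * β ≤ δ) : δ ≤ q ^ 2 := by
  by_contra hc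
  push Not at hc
  have h1 : δ * δ < δ * δ := by
    calc δ * δ < (q * β) * (q * β) := Nat.mul_lt_mul'' h h
      _ = q ^ 2 * (β * β) := by ring
      _ ≤ δ * δ := Nat.mul_le_mul hc.le hβ
  exact lt_irrefl _ h1

theorem sqrt_mul_mul_le {x y c : ℝ} (hx : 0 ≤ x) (hy : 0 ≤ y) (hc : 1 ≤ c) :
    Real.sqrt (x * (c * y)) ≤ c * Real.sqrt (x * y) := by
  have hxy : 0 ≤ x * y := mul_nonneg hx hy
  rw [Real.sqrt_le_left (by positivity), mul_pow, Real.sq_sqrt hxy]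
  nlinarith [mul_nonneg hxy (mul_nonneg (by linarith : 0 ≤ c) (sub_nonneg.2 hc))]

theorem sqrt_half_le (x : ℝ) : Real.sqrt (x / 2) ≤ 3 / 4 * Real.sqrt x := by
  rcases le_total x 0 with h | h
  · rw [Real.sqrt_eq_zero_of_nonpos (by linarith), Real.sqrt_eq_zero_of_nonpos h]
    simp
  · rw [Real.sqrt_le_left (by positivity), mul_pow, Real.sq_sqrt h]
    linarith

/-- Stages that halve the number of uncolored neighbors, followed by a stage that colors all
nodes. -/
theorem exists_colorsWithin (b e : ℕ) (hb : 1 ≤ b) : ∃ (N₀ : ℕ) (K : ℝ), 0 ≤ K ∧ ∀ N ≥ N₀,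
    ∀ (C : Type) [Fintype C] [Nonempty C], Fintype.card C ≤ 2 ^ N ^ e → ∀ m ≤ N ^ b,
    ∀ M ≥ N ^ (e + 7), ColorsWithin C M m N (K * Real.sqrt (N * Nat.log 2 N)) := by
  obtain ⟨N₁, hN₁⟩ := exists_pow_log_le (24 * (2 * (e + 3)))
  -- In a halving stage `N ≤ δ ^ 8` and `δ ≤ q ^ 2`, hence `N ^ b ≤ q ^ (16 * b)`: polynomials of
  -- bounded degree distinguish all colors.
  set D := 16 * b with hD
  set K₁ : ℝ := (16 * D + 9) * (24 * (2 * (e + 3))) with hK₁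
  refine ⟨N₁ + 6 * (2 * b + 25) + 2 * (e + 3) + (4 * D ^ 2) ^ 4 + (4 * D + 8), 4 * K₁ + 9,
    by positivity, fun N hN C _ _ hC m hm M hM => ?_⟩
  set lam := Nat.log 2 N with hlam
  have hlam1 : 1 ≤ lam := Nat.le_log_of_pow_le (by norm_num) (by omega)
  have hlamR : (1 : ℝ) ≤ lam := by exact_mod_cast hlam1
  have hMN : N ^ 2 ≤ M := le_trans (Nat.pow_le_pow_right (by omega) (by omega)) hM
  have hqM : 4 * D * N + 2 + 6 ≤ M := by
    refine le_trans ?_ hMN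
    calc 4 * D * N + 2 + 6 ≤ 4 * D * N + 8 * N := by omega
      _ = (4 * D + 8) * N := by ring
      _ ≤ N * N := Nat.mul_le_mul_right _ (by omega)
      _ = N ^ 2 := (sq N).symm
  have hRM : N + N ^ (e + 5) + 4 ≤ M := by
    refine le_trans ?_ hM
    have h1 : N ≤ N ^ (e + 5) := Nat.le_self_pow (by omega) N
    calc N + N ^ (e + 5) + 4 ≤ 3 * N ^ (e + 5) := by omega
      _ ≤ N ^ 2 * N ^ (e + 5) := Nat.mul_le_mul_right _
          (le_trans (by norm_num) (Nat.pow_le_pow_left (show 2 ≤ N by omega) 2))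
      _ = _ := by ring
  have main : ∀ δ ≤ N, ColorsWithin C M m δ (4 * K₁ * Real.sqrt (δ * lam) + 9 * Real.sqrt N) := by
    intro δ
    induction δ using Nat.strong_induction_on with
    | _ δ ih =>
    intro hδN
    -- For `δ` below the eighth root of `N`, a prime of order `√N` exceeds `2 * D * δ`, and one last
    -- stage of `O(√N)` rounds finishes.
    rcases Nat.lt_or_ge (δ ^ 8) N with hδ | hδ
    · obtain ⟨q, hq, h1, h2⟩ := Nat.exists_prime_lt_and_le_two_mul (Nat.sqrt N)
        (by have := Nat.sqrt_pos.2 (show 0 < N by omega); omega)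
      have hqN : N ≤ q ^ 2 := by
        have := Nat.sqrt_lt'.1 h1
        exact this.le
      have hsN : Nat.sqrt N ≤ N := Nat.sqrt_le_self N
      refine (colorsWithin_of_prime (D := D) hq (by omega) ?_ ?_ ?_).mono ?_
      · calc m ≤ N ^ b := hm
          _ ≤ (q ^ 2) ^ b := Nat.pow_le_pow_left hqN b
          _ = q ^ (2 * b) := by rw [pow_mul]
          _ ≤ q ^ D := Nat.pow_le_pow_right hq.pos (by omega)
      · by_contra hc
        push Not at hc
        have h3 : N ^ 4 ≤ (4 * D ^ 2) ^ 4 * δ ^ 8 := by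
          calc N ^ 4 ≤ (q ^ 2) ^ 4 := Nat.pow_le_pow_left hqN 4
            _ ≤ ((2 * D * δ) ^ 2) ^ 4 := by gcongr
            _ = _ := by ring
        have h4 : N ^ 4 < N ^ 4 := by
          calc N ^ 4 ≤ (4 * D ^ 2) ^ 4 * δ ^ 8 := h3
            _ ≤ N * δ ^ 8 := Nat.mul_le_mul_right _ (by omega)
            _ < N * N := Nat.mul_lt_mul_of_pos_left hδ (by omega)
            _ = N ^ 2 := (sq N).symm
            _ ≤ N ^ 4 := Nat.pow_le_pow_right (by omega) (by norm_num)
        exact lt_irrefl _ h4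
      · have : 2 * N ≤ 4 * D * N := Nat.mul_le_mul_right _ (by omega)
        omega
      · have h3 : (q : ℝ) ≤ 2 * Real.sqrt N := by
          have h4 : (q : ℝ) ≤ 2 * (Nat.sqrt N : ℝ) := by exact_mod_cast h2
          have := Real.nat_sqrt_le_real_sqrt (a := N)
          linarith
        have h5 : 1 ≤ Real.sqrt N := by
          rw [Real.one_le_sqrt]
          have : 1 ≤ N := by omega
          exact_mod_cast this
        have h6 : 0 ≤ 4 * K₁ * Real.sqrt (δ * lam) := by positivity
        linarith
    · set σ := 2 * (e + 3) * lam with hσ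
      have hσ1 : 1 ≤ σ := by rw [hσ]; nlinarith
      have hσδ : 24 * σ ≤ δ := by
        have h1 := hN₁ N (by omega)
        rw [← hlam, show 24 * (2 * (e + 3)) * lam = 24 * σ by rw [hσ]; ring] at h1
        exact (Nat.pow_le_pow_iff_left (by norm_num)).1 (h1.trans hδ)
      -- The largest `β` for which the bound `12 * β² * σ` on `l` is at most `δ / 2`.
      set β := Nat.sqrt (δ / (24 * σ)) with hβ
      have hβ1 : 1 ≤ β := Nat.sqrt_pos.2 (Nat.div_pos hσδ (by omega))
      have hββ : β * β * (24 * σ) ≤ δ :=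
        (Nat.mul_le_mul_right _ (Nat.sqrt_le _)).trans (Nat.div_mul_le_self _ _)
      have hβlt : δ < (β + 1) ^ 2 * (24 * σ) := by
        rw [← Nat.div_lt_iff_lt_mul (by omega), sq]
        exact Nat.lt_succ_sqrt _
      have hβδ : β * β ≤ δ := le_trans (Nat.le_mul_of_pos_right _ (by omega)) hββ
      obtain ⟨l, R, τ, F, hF, hl1, hlσ, hR⟩ := exists_isListFamily_of_pow (C := C) b e N m β
        (by omega) (by omega) hC hm hβ1 (hβδ.trans hδN)
      have hlδ : 2 * l ≤ δ := by
        calc 2 * l ≤ 2 * (12 * (β * β) * σ) := Nat.mul_le_mul_left _ hlσ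
          _ = β * β * (24 * σ) := by ring
          _ ≤ δ := hββ
      obtain ⟨Q, hQ⟩ : ∃ Q, Q = 2 * D * δ / (β + 1) + 1 := ⟨_, rfl⟩
      obtain ⟨q, hq, h1, h2⟩ := Nat.exists_prime_lt_and_le_two_mul Q
        (by rw [hQ]; exact Nat.succ_ne_zero _)
      have hQβ : 2 * D * δ < Q * (β + 1) := by
        rw [hQ, ← Nat.div_lt_iff_lt_mul (Nat.succ_pos β)]
        exact Nat.lt_succ_self _
      have hqβ : 2 * D * δ < q * (β + 1) := hQβ.trans_le (Nat.mul_le_mul_right _ h1.le)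
      have hQδ : δ ≤ q ^ 2 := by
        refine le_sq_of_lt_mul_of_sq_le (β := β) ?_ hβδ
        have h3 : 2 * δ < 2 * (q * β) := by
          calc 2 * δ ≤ 2 * D * δ := Nat.mul_le_mul_right _ (by omega)
            _ < q * (β + 1) := hqβ
            _ ≤ q * (2 * β) := Nat.mul_le_mul_left _ (by omega)
            _ = _ := by ring
        omega
      have hQle : Q ≤ 2 * D * δ + 1 := by
        rw [hQ]
        exact Nat.add_le_add_right (Nat.div_le_self _ _) 1
      have hDδ : D * δ ≤ D * N := Nat.mul_le_mul_left _ hδN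
      refine (ColorsWithin.of_stage (D := D) hq (by omega) ?_ hqβ hF hl1 ?_ ?_
        (show l - 2 ≤ δ / 2 by omega) (ih (δ / 2) (by omega) (by omega))).mono ?_
      · calc m ≤ N ^ b := hm
          _ ≤ (δ ^ 8) ^ b := Nat.pow_le_pow_left hδ b
          _ ≤ ((q ^ 2) ^ 8) ^ b := by gcongr
          _ = q ^ D := by rw [← pow_mul, ← pow_mul, hD]; congr 1; ring
      · have h3 : 2 * D * δ = 2 * (D * δ) := by ring
        have h4 : 4 * D * N = 4 * (D * N) := by ring
        omega
      · omega
      · have h3 := four_mul_prime_add_one_le hQ h2 hβlt (by omega) (by omega)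
        have h4 : Real.sqrt (δ * ((24 * σ : ℕ) : ℝ)) ≤
            (24 * (2 * (e + 3))) * Real.sqrt (δ * lam) := by
          have h5 := sqrt_mul_mul_le (x := δ) (c := 24 * (2 * (e + 3))) (y := lam)
            (by positivity) (by positivity) (by linarith [Nat.cast_nonneg (α := ℝ) e])
          rw [hσ]
          push_cast
          rwa [← mul_assoc 24]
        have h7 : (4 * q + 1 : ℝ) ≤ K₁ * Real.sqrt (δ * lam) := by
          refine h3.trans ?_
          rw [hK₁, mul_assoc]
          gcongr
        have h8 : Real.sqrt ((δ / 2 : ℕ) * lam) ≤ 3 / 4 * Real.sqrt (δ * lam) := by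
          refine le_trans (Real.sqrt_le_sqrt ?_) (sqrt_half_le _)
          have : ((δ / 2 : ℕ) : ℝ) ≤ δ / 2 := Nat.cast_div_le
          calc ((δ / 2 : ℕ) : ℝ) * lam ≤ δ / 2 * lam := by gcongr
            _ = _ := by ring
        -- Halving `δ` shrinks the root by a factor at most `3/4`, so the constant reproduces
        -- itself: `K₁ + 4 * K₁ * (3/4) = 4 * K₁`.
        have h9 := mul_le_mul_of_nonneg_left h8 (show 0 ≤ 4 * K₁ by positivity)
        linarith
  refine (main N le_rfl).mono ?_
  have h1 : Real.sqrt N ≤ Real.sqrt (N * lam) := by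
    apply Real.sqrt_le_sqrt
    exact le_mul_of_one_le_right (Nat.cast_nonneg N) hlamR
  linarith

/-- Covers the cases without a suitable bound on the color space: bounded `N`, and `N` small
compared with the given `Δ`. -/
theorem colorsWithin_linear {b N m M : ℕ} (hb : 1 ≤ b) (hN : 2 ≤ N) (hm : m ≤ N ^ b)
    (hM : 4 * b * N + 6 ≤ M) : ColorsWithin C M m N (16 * b * N + 1) := by
  have hbN : 1 ≤ b * N := Nat.mul_pos hb (by omega)
  obtain ⟨q, hq, h1, h2⟩ := Nat.exists_prime_lt_and_le_two_mul (2 * b * N)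
    (by have : 2 * b * N = 2 * (b * N) := by ring
        omega)
  have hNq : N ≤ q := by
    have : 1 * N ≤ 2 * b * N := Nat.mul_le_mul_right _ (by omega)
    omega
  have h3 : 2 * (2 * b * N) = 4 * b * N := by ring
  refine (colorsWithin_of_prime hq hb (hm.trans (Nat.pow_le_pow_left hNq b)) h1
    (by omega)).mono ?_
  have : (q : ℝ) ≤ 4 * b * N := by exact_mod_cast h2.trans h3.le
  linarith

end Phases

/-! ### Assembling the two phases. -/

section Assembly

/-- A proper coloring is a partial list coloring in which no node has chosen a color. -/
theorem ColoringInvariant.stageInvariant {C V : Type} [Nonempty C] [Fintype V] {G : SimpleGraph V}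
    [DecidableRel G.Adj] {L : V → Finset C} {M m δ : ℕ} {s : V → NodeState C}
    (h : ColoringInvariant G M m s) (hδ : ∀ v, G.degree v ≤ δ) : StageInvariant G L M m δ s := by
  have h3 : ∀ v, (s v).vars.status ≠ 3 := fun v => by rw [h.status v]; norm_num
  refine ⟨⟨h.bounded, h.color_lt, h.color_ne, fun v hv => absurd hv (h3 v),
    fun v hv => absurd hv (h3 v), fun u v _ hu _ => absurd hu (h3 u),
    fun v _ => h.palette_empty v⟩, fun v => Or.inl (h.status v), fun v _ => ?_⟩
  refine (Finset.card_filter_le _ _).trans ?_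
  rw [G.card_neighborFinset_eq_degree]
  exact hδ v

theorem ColoringInvariant.start {C V : Type} {G : SimpleGraph V} {M m : ℕ} {ident : V → ℕ}
    (hinj : Function.Injective ident) (hid : ∀ v, ident v < m) (hM : m ≤ M) :
    ColoringInvariant G M m fun v => startState C (ident v) := by
  refine ⟨fun v => ?_, hid, fun u v huv h => huv.ne (hinj h), fun _ => rfl, fun _ => rfl⟩
  have := hid v
  have hM0 : 0 < M := by omega
  exact ⟨by simp only [startState]; omega, hM0, hM0, hM0, hM0⟩

theorem oneListMessage_of_degree_eq_zero {C V : Type} [Fintype V] (A : LocalAlgorithm C)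
    (G : SimpleGraph V) [DecidableRel G.Adj] (p : PortNumbering G) (ident : V → ℕ)
    (L : V → Finset C) (T b : ℕ) (h : ∀ v, G.degree v = 0) : OneListMessage A G p ident L T b :=
  fun v => ⟨0, ∅, by simp, fun _ _ => Or.inl fun i => absurd i.2 (by have := h v; omega)⟩

/-- The round bound of the coloring phase in terms of the given degree bound. -/
theorem sqrt_mul_log_le {N Δ : ℕ} (hN : N ≤ Δ + 2) :
    Real.sqrt (N * Nat.log 2 N) ≤ 2 * (Real.sqrt (Δ * Real.logb 2 Δ) + 1) := by
  have h0 := Real.sqrt_nonneg (Δ * Real.logb 2 Δ)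
  rcases Nat.lt_or_ge Δ 2 with h | h
  · have h1 : Real.sqrt (N * Nat.log 2 N) ≤ 2 := by
      rw [Real.sqrt_le_left (by norm_num)]
      have h2 : Nat.log 2 N ≤ 1 := by
        calc Nat.log 2 N ≤ Nat.log 2 3 := Nat.log_mono_right (by omega)
          _ = 1 := by norm_num [Nat.log]
      have h3 : N * Nat.log 2 N ≤ 3 * 1 := Nat.mul_le_mul (by omega) h2
      have h4 : ((N * Nat.log 2 N : ℕ) : ℝ) ≤ ((3 * 1 : ℕ) : ℝ) := by exact_mod_cast h3
      push_cast at h4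
      linarith
    linarith
  · have hΔ : (2 : ℝ) ≤ Δ := by exact_mod_cast h
    have hlog1 : 1 ≤ Real.logb 2 Δ := by
      rw [Real.le_logb_iff_rpow_le (by norm_num) (by linarith)]
      simpa using hΔ
    have hNΔ : (N : ℝ) ≤ 2 * Δ := by
      have : N ≤ 2 * Δ := by omega
      exact_mod_cast this
    have hlogN : (Nat.log 2 N : ℝ) ≤ 2 * Real.logb 2 Δ := by
      rcases Nat.eq_zero_or_pos N with rfl | hpos
      · simp
        linarith
      · calc (Nat.log 2 N : ℝ) ≤ Real.logb 2 N := Real.natLog_le_logb N 2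
          _ ≤ Real.logb 2 (2 * Δ) := Real.logb_le_logb_of_le (by norm_num)
              (by exact_mod_cast hpos) hNΔ
          _ = 1 + Real.logb 2 Δ := by
              rw [Real.logb_mul (by norm_num) (by linarith), Real.logb_self_eq_one (by norm_num)]
          _ ≤ _ := by linarith
    have h1 : Real.sqrt (N * Nat.log 2 N) ≤ 2 * Real.sqrt (Δ * Real.logb 2 Δ) := by
      rw [Real.sqrt_le_left (by positivity), mul_pow, Real.sq_sqrt (by positivity)]
      calc (N : ℝ) * Nat.log 2 N ≤ (2 * Δ) * (2 * Real.logb 2 Δ) := by gcongr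
        _ = _ := by ring
    linarith

theorem le_sqrt_mul_logb {N Δ : ℕ} (hN : 2 ≤ N) (h : N ^ 8 ≤ Δ) :
    (N : ℝ) ≤ Real.sqrt (Δ * Real.logb 2 Δ) := by
  have hN2 : N ^ 2 ≤ Δ := (Nat.pow_le_pow_right (by omega) (by norm_num)).trans h
  have hΔ : (2 : ℝ) ≤ Δ := by
    have : 2 ≤ Δ := by nlinarith
    exact_mod_cast this
  have hlog1 : 1 ≤ Real.logb 2 Δ := by
    rw [Real.le_logb_iff_rpow_le (by norm_num) (by linarith)]
    simpa using hΔ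
  apply Real.le_sqrt_of_sq_le
  have h2 : (N : ℝ) ^ 2 ≤ Δ := by exact_mod_cast hN2
  nlinarith

theorem color_space_exponent_le {a c N Δ : ℕ} (hN : 2 ≤ N) (hΔ : Δ < N ^ 8) :
    a * (Δ ^ c + 1) ≤ N ^ (8 * c + a + 1) := by
  have h1 : a ≤ N ^ a := Nat.lt_two_pow_self.le.trans (Nat.pow_le_pow_left hN a)
  have h2 : Δ ^ c ≤ N ^ (8 * c) := by
    rw [pow_mul]
    exact Nat.pow_le_pow_left hΔ.le c
  have h3 : 1 ≤ N ^ (8 * c) := Nat.one_le_pow _ _ (by omega)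
  calc a * (Δ ^ c + 1) ≤ N ^ a * (2 * N ^ (8 * c)) := by gcongr; omega
    _ ≤ N ^ a * (N * N ^ (8 * c)) := by gcongr
    _ = _ := by ring

/-- The coloring phase, for all values of the parameters. -/
theorem exists_colorsWithin_of_degree (a c b : ℕ) (hb : 1 ≤ b) : ∃ (K : ℝ) (B : ℕ),
    ∀ (n Δ : ℕ) (C : Type) [Fintype C] [Nonempty C],
      Fintype.card C ≤ 2 ^ (a * (Δ ^ c + 1)) → ∀ m ≤ (min Δ n + 2) ^ b, ∀ M ≥ (n + 2) ^ B,
      ColorsWithin C M m (min Δ n + 2) (K * (Real.sqrt (Δ * Real.logb 2 Δ) + 1)) := by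
  obtain ⟨N₀, K, hK, h⟩ := exists_colorsWithin b (8 * c + a + 1) hb
  refine ⟨2 * K + (16 * b * N₀ + 1) + (16 * b + 1), (8 * c + a + 1 + 7) + (4 * b + 4),
    fun n Δ C _ _ hC m hm M hM => ?_⟩
  -- `N` bounds the actual degrees and is at most `n + 2`, which keeps the numbers in messages
  -- polynomial in `n` even if `Δ` is far larger than `n`.
  set N := min Δ n + 2 with hN
  have hNn : N ≤ n + 2 := by omega
  have hNΔ : N ≤ Δ + 2 := by omega
  have hN2 : 2 ≤ N := by omega
  have h0 := Real.sqrt_nonneg (Δ * Real.logb 2 Δ)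
  set S := Real.sqrt (Δ * Real.logb 2 Δ) with hS
  have hlin : 4 * b * N + 6 ≤ M := by
    have h1 : 4 * b ≤ N ^ (4 * b) := Nat.lt_two_pow_self.le.trans (Nat.pow_le_pow_left hN2 _)
    have h2 : 1 ≤ N ^ (4 * b) := Nat.one_le_pow _ _ (by omega)
    have h4 : N ^ (4 * b) * (N + 6) ≤ N ^ (4 * b) * N ^ 4 := by
      refine Nat.mul_le_mul_left _ ?_
      have : 2 ^ 3 ≤ N ^ 3 := Nat.pow_le_pow_left hN2 3
      calc N + 6 ≤ 8 * N := by omega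
        _ ≤ N ^ 3 * N := Nat.mul_le_mul_right _ this
        _ = N ^ 4 := by ring
    calc 4 * b * N + 6 ≤ N ^ (4 * b) * N + N ^ (4 * b) * 6 :=
          Nat.add_le_add (Nat.mul_le_mul_right _ h1) (by omega)
      _ = N ^ (4 * b) * (N + 6) := by ring
      _ ≤ N ^ (4 * b) * N ^ 4 := h4
      _ = N ^ (4 * b + 4) := by rw [pow_add]
      _ ≤ (n + 2) ^ (4 * b + 4) := Nat.pow_le_pow_left hNn _
      _ ≤ (n + 2) ^ ((8 * c + a + 1 + 7) + (4 * b + 4)) :=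
          Nat.pow_le_pow_right (by omega) (by omega)
      _ ≤ M := hM
  have hbR : (1 : ℝ) ≤ b := by exact_mod_cast hb
  have hN0R : (0 : ℝ) ≤ 16 * b * N₀ := by positivity
  rcases Nat.lt_or_ge N N₀ with hlt | hge
  · refine (colorsWithin_linear hb hN2 hm hlin).mono ?_
    have h1 : (N : ℝ) ≤ N₀ := by exact_mod_cast hlt.le
    have h2 : 16 * (b : ℝ) * N ≤ 16 * b * N₀ := by gcongr
    calc 16 * (b : ℝ) * N + 1 ≤ (16 * b * N₀ + 1) * 1 := by linarith
      _ ≤ (2 * K + (16 * b * N₀ + 1) + (16 * b + 1)) * (S + 1) := by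
          gcongr <;> linarith
  -- If `Δ < N ^ 8`, the color space is also bounded in terms of `N`. Otherwise `N ≤ √Δ`, and
  -- linearly many rounds in `N` are affordable.
  · rcases Nat.lt_or_ge Δ (N ^ 8) with hlt8 | hge8
    · refine (h N hge C (hC.trans (Nat.pow_le_pow_right (by norm_num)
        (color_space_exponent_le hN2 hlt8))) m hm M ?_).mono ?_
      · calc N ^ (8 * c + a + 1 + 7) ≤ (n + 2) ^ (8 * c + a + 1 + 7) :=
              Nat.pow_le_pow_left hNn _
          _ ≤ (n + 2) ^ ((8 * c + a + 1 + 7) + (4 * b + 4)) :=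
              Nat.pow_le_pow_right (by omega) (by omega)
          _ ≤ M := hM
      · calc K * Real.sqrt (N * Nat.log 2 N) ≤ K * (2 * (S + 1)) := by
              gcongr
              exact sqrt_mul_log_le hNΔ
          _ = (2 * K) * (S + 1) := by ring
          _ ≤ (2 * K + (16 * b * N₀ + 1) + (16 * b + 1)) * (S + 1) := by
              gcongr
              linarith
    · refine (colorsWithin_linear hb hN2 hm hlin).mono ?_
      have h1 : (N : ℝ) ≤ S := le_sqrt_mul_logb hN2 hge8
      calc 16 * (b : ℝ) * N + 1 ≤ 16 * b * S + 1 := by gcongr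
        _ ≤ (16 * b + 1) * (S + 1) := by nlinarith
        _ ≤ (2 * K + (16 * b * N₀ + 1) + (16 * b + 1)) * (S + 1) :=
            mul_le_mul_of_nonneg_right (by linarith) (by linarith)

end Assembly

/-- For all constants `a`, `c` (color space of size `2 ^ O(Δ ^ c)`) and `k` (identifiers of
`k * log n` bits) there are constants `K` and `B` such that, for all globally known `n`, `Δ` and
color space `C`, one deterministic algorithm solves every (deg+1)-list coloring instance on every
`n`-node graph of maximum degree at most `Δ` within the stated number of rounds, and all its
messages have at most `B * log n` bits, except that each node may once broadcast a subset of its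
list. The summand `1` next to the square root only matters for `Δ ≤ 1`. -/
theorem theorem3 (a c k : ℕ) :
    ∃ (K : ℝ) (B : ℕ), ∀ (n Δ : ℕ) (C : Type) [Fintype C] [Nonempty C],
      Fintype.card C ≤ 2 ^ (a * (Δ ^ c + 1)) →
      ∃ (A : LocalAlgorithm C) (T : ℕ),
        (T : ℝ) ≤ K * (Real.sqrt (Δ * Real.logb 2 Δ) + 1) + (1 / 2) * (logStar n : ℝ) ∧
        ∀ (V : Type) [Fintype V] (G : SimpleGraph V) [DecidableRel G.Adj],
          Fintype.card V = n →
          (∀ v, G.degree v ≤ Δ) →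
          ∀ (p : PortNumbering G) (ident : V → ℕ) (L : V → Finset C),
            Function.Injective ident →
            (∀ v, ident v < n ^ k) →
            (∀ v, G.degree v + 1 ≤ (L v).card) →
            IsListColoring G L (A.color G p ident L T) ∧
            OneListMessage A G p ident L T (B * Nat.log 2 n) := by

  obtain ⟨b, hb⟩ := exists_reducesWithin_pow k
  obtain ⟨K, B, hcol⟩ := exists_colorsWithin_of_degree a c (b + 1) (by omega)
  refine ⟨K + 4, 20 * (B + k + 1), fun n Δ C _ _ hC => ?_⟩
  set d := min Δ n with hd
  obtain ⟨T₁, hT₁, m, hm, hred⟩ := hb n d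
  set M := (n + 2) ^ (B + k + 1) with hM
  have hnM : n ^ k ≤ M :=
    (Nat.pow_le_pow_left (by omega) k).trans (Nat.pow_le_pow_right (by omega) (by omega))
  obtain ⟨prog₁, hlen₁, hprog₁⟩ := hred.exists_rules C M hnM
  obtain ⟨prog₂, hlen₂, hprog₂⟩ := hcol n Δ C hC m
    (hm.trans (Nat.pow_le_pow_right (by omega) (by omega))) M
    (Nat.pow_le_pow_right (by omega) (by omega))
  -- For `n ≤ 1` the permitted message length is `0`, but there are no edges, so any code length
  -- will do. For `n ≥ 2`, `n + 2 ≤ 2 ^ (4 * log n)` yields the factor `20 = 4 * 5`.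
  obtain ⟨bits, hbits, hbits₂⟩ : ∃ bits, M ^ 5 ≤ 2 ^ bits ∧
      (2 ≤ n → bits = 20 * (B + k + 1) * Nat.log 2 n) := by
    rcases Nat.lt_or_ge n 2 with h | h
    · exact ⟨M ^ 5, Nat.lt_two_pow_self.le, fun h' => by omega⟩
    · refine ⟨_, ?_, fun _ => rfl⟩
      have hlog : 1 ≤ Nat.log 2 n := Nat.le_log_of_pow_le (by norm_num) (by omega)
      have h1 : n + 2 ≤ 2 ^ (4 * Nat.log 2 n) := by
        have h2 : n < 2 ^ (Nat.log 2 n + 1) := Nat.lt_pow_succ_log_self (by norm_num) n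
        calc n + 2 ≤ n ^ 2 := by nlinarith
          _ ≤ (2 ^ (Nat.log 2 n + 1)) ^ 2 := Nat.pow_le_pow_left h2.le 2
          _ = 2 ^ ((Nat.log 2 n + 1) * 2) := by rw [pow_mul]
          _ ≤ _ := Nat.pow_le_pow_right (by norm_num) (by omega)
      calc M ^ 5 = (n + 2) ^ ((B + k + 1) * 5) := by rw [hM, ← pow_mul]
        _ ≤ (2 ^ (4 * Nat.log 2 n)) ^ ((B + k + 1) * 5) := Nat.pow_le_pow_left h1 _
        _ = 2 ^ (20 * (B + k + 1) * Nat.log 2 n) := by rw [← pow_mul]; congr 1; ring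
  obtain ⟨enc, dec, henc, hdec⟩ := exists_encoding M bits hbits
  refine ⟨simulation M enc dec (prog₁ ++ prog₂) NodeState.chosen, (prog₁ ++ prog₂).length, ?_,
    fun V _ G _ hV hΔ p ident L hinj hid hL => ?_⟩
  · rw [List.length_append, hlen₁]
    push_cast
    have h1 : (T₁ : ℝ) ≤ 1 / 2 * (logStar n : ℝ) + 4 := by
      have h2 : ((logStar n / 2 : ℕ) : ℝ) ≤ (logStar n : ℝ) / 2 := Nat.cast_div_le
      have h3 : (T₁ : ℝ) ≤ ((logStar n / 2 : ℕ) : ℝ) + 4 := by exact_mod_cast hT₁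
      linarith
    have h0 := Real.sqrt_nonneg (Δ * Real.logb 2 Δ)
    nlinarith
  · have hdn : ∀ v, G.degree v < n := fun v => hV ▸ G.degree_lt_card_verts v
    have hdeg : ∀ v, G.degree v ≤ d := fun v => le_min (hΔ v) (hdn v).le
    obtain ⟨hout, hmsg⟩ := simulation_spec M bits enc dec henc hdec (prog₁ ++ prog₂)
      NodeState.chosen G p ident L (fun v => (hid v).trans_le hnM)
    refine ⟨?_, ?_⟩
    · have hinv := hprog₁ V G L _ hdeg (ColoringInvariant.start (C := C) hinj hid hnM)
      obtain ⟨hcons, hst⟩ := hprog₂ V G L _ hL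
        (hinv.stageInvariant (δ := d + 2) fun v => (hdeg v).trans (by omega))
      rw [← run_append] at hcons hst
      refine ⟨fun v => ?_, fun u v huv => ?_⟩
      · rw [hout]
        exact hcons.palette_subset v (hst v) (nthColor_mem (hcons.index_lt v (hst v)))
      · rw [hout, hout]
        exact hcons.chosen_ne u v huv (hst u) (hst v)
    · rcases Nat.lt_or_ge n 2 with h | h
      · exact oneListMessage_of_degree_eq_zero _ G p ident L _ _
          fun v => by have := hdn v; omega
      · rw [← hbits₂ h]
        exact hmsg
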